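/- Let $\lambda$ be Lebesgue measure on $[0,1]$; "measurable" means Lebesgue measurable. A graphon is a symmetric measurable function $U:[0,1]^2\to[0,1]$. For an integer $k\ge 1$, a $k$-coloured graphon is a pair $(U,\mathcal A)$ consisting of a graphon $U$ and an ordered partition $\mathcal A=(A_1,\dots,A_k)$ of $[0,1]$ into $k$ measurable (possibly empty) sets. For $k$-coloured graphons $(U,\mathcal A)$, $(V,\mathcal B)$ let $$d^{(k)}_\Box((U,\mathcal A),(V,\mathcal B)):=\sup_{C,D}\ \sum_{i,j=1}^k\left|\int_{C\times D}\left(\mathbf 1_{A_i\times A_j}U-\mathbf 1_{B_i\times B_j}V\right)d\lambda^{\otimes 2}\right|+\sum_{i=1}^k\lambda(A_i\triangle B_i),$$ the supremum being over all measurable $C,D\subseteq[0,1]$, and $$\delta^{(k)}_\Box((U,\mathcal A),(V,\mathcal B)):=\inf_{\phi,\psi} d^{(k)}_\Box((U,\mathcal A)^\phi,(V,\mathcal B)^\psi),$$ the infimum being over all measure-preserving maps $\phi,\psi:[0,1]\to[0,1]$, where $(U,\mathcal A)^\phi:=(U^\phi,(\phi^{-1}(A_1),\dots,\phi^{-1}(A_k)))$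 and $U^\phi(x,y):=U(\phi(x),\phi(y))$. **Theorem.** For every integer $k\ge1$, let $\widetilde{\mathcal W}^{(k)}$ be the set of $k$-coloured graphons with any two at $\delta^{(k)}_\Box$-distance $0$ identified. Then $\delta^{(k)}_\Box$ is a well-defined metric on $\widetilde{\mathcal W}^{(k)}$, and the metric space $(\widetilde{\mathcal W}^{(k)},\delta^{(k)}_\Box)$ is compact. -/

import Mathlib

open MeasureTheory
open scoped unitInterval

noncomputable section

/-- A graphon: a symmetric Lebesgue measurable function `[0,1]² → [0,1]`.
`NullMeasurable` is measurability for the completed `σ`-algebra. -/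
structure Graphon where
  toFun : I × I → ℝ
  mem_Icc : ∀ z, toFun z ∈ Set.Icc (0 : ℝ) 1
  symm : ∀ x y, toFun (x, y) = toFun (y, x)
  measurable : NullMeasurable toFun (volume : Measure (I × I))

/-- An ordered partition of `[0,1]` into `k` Lebesgue measurable sets (parts may be empty). -/
structure OrderedPartition (k : ℕ) where
  part : Fin k → Set I
  measurable : ∀ i, NullMeasurableSet (part i) (volume : Measure I)
  disjoint : ∀ i j, i ≠ j → Disjoint (part i) (part j)
  iUnion_eq : ⋃ i, part i = Set.univ

/-- A measure-preserving map `[0,1] → [0,1]`, with respect to Lebesgue measurable sets. -/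
structure MeasurePreservingMap where
  toFun : I → I
  measurable : ∀ X : Set I, NullMeasurableSet X (volume : Measure I) →
    NullMeasurableSet (toFun ⁻¹' X) (volume : Measure I)
  volume_preimage : ∀ X : Set I, NullMeasurableSet X (volume : Measure I) →
    (volume : Measure I) (toFun ⁻¹' X) = (volume : Measure I) X

theorem MeasurePreservingMap.nullMeasurable_comp (φ : MeasurePreservingMap) (U : I × I → ℝ)
    (hU : NullMeasurable U (volume : Measure (I × I))) :
    NullMeasurable (fun z : I × I => U (φ.toFun z.1, φ.toFun z.2))
      (volume : Measure (I × I)) := by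
  have hφ : AEMeasurable φ.toFun (volume : Measure I) :=
    NullMeasurable.aemeasurable fun s hs => φ.measurable s hs.nullMeasurableSet
  have hae : φ.toFun =ᵐ[volume] hφ.mk φ.toFun := hφ.ae_eq_mk
  have hmp : MeasurePreserving (hφ.mk φ.toFun) (volume : Measure I) volume := by
    refine ⟨hφ.measurable_mk, ?_⟩
    ext s hs
    rw [Measure.map_apply hφ.measurable_mk hs, ← φ.volume_preimage s hs.nullMeasurableSet]
    refine measure_congr ?_
    filter_upwards [hae] with x hx
    exact congrArg s hx.symm
  have h2 : MeasurePreserving (Prod.map (hφ.mk φ.toFun) (hφ.mk φ.toFun))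
      (volume : Measure (I × I)) volume := hmp.prod hmp
  have hUa : AEMeasurable U (volume : Measure (I × I)) := hU.aemeasurable
  have h3 : AEMeasurable (U ∘ Prod.map (hφ.mk φ.toFun) (hφ.mk φ.toFun))
      (volume : Measure (I × I)) :=
    hUa.comp_quasiMeasurePreserving h2.quasiMeasurePreserving
  have e1 : ∀ᵐ z : I × I ∂volume, φ.toFun z.1 = hφ.mk φ.toFun z.1 :=
    (Measure.quasiMeasurePreserving_fst (μ := (volume : Measure I))
      (ν := (volume : Measure I))).ae hae
  have e2 : ∀ᵐ z : I × I ∂volume, φ.toFun z.2 = hφ.mk φ.toFun z.2 :=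
    (Measure.quasiMeasurePreserving_snd (μ := (volume : Measure I))
      (ν := (volume : Measure I))).ae hae
  refine (h3.congr ?_).nullMeasurable
  filter_upwards [e1, e2] with z h1 h2
  simp [Prod.map, h1, h2]

/-- The pull-back `U^φ (x, y) = U (φ x, φ y)`. -/
def Graphon.pullback (U : Graphon) (φ : MeasurePreservingMap) : Graphon where
  toFun := fun z => U.toFun (φ.toFun z.1, φ.toFun z.2)
  mem_Icc _ := U.mem_Icc _
  symm _ _ := U.symm _ _
  measurable := φ.nullMeasurable_comp U.toFun U.measurable

/-- The pull-back of a partition, with parts `φ⁻¹(A_i)`. -/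
def OrderedPartition.pullback {k : ℕ} (A : OrderedPartition k) (φ : MeasurePreservingMap) :
    OrderedPartition k where
  part i := φ.toFun ⁻¹' A.part i
  measurable i := φ.measurable _ (A.measurable i)
  disjoint i j h := (A.disjoint i j h).preimage _
  iUnion_eq := by rw [← Set.preimage_iUnion, A.iUnion_eq, Set.preimage_univ]

/-- A `k`-coloured graphon. -/
structure ColouredGraphon (k : ℕ) where
  graphon : Graphon
  partition : OrderedPartition k

namespace ColouredGraphon

variable {k : ℕ}

def pullback (X : ColouredGraphon k) (φ : MeasurePreservingMap) : ColouredGraphon k :=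
  ⟨X.graphon.pullback φ, X.partition.pullback φ⟩

/-- `𝟙_{A_i × A_j} U`. -/
def block (X : ColouredGraphon k) (i j : Fin k) : I × I → ℝ :=
  (X.partition.part i ×ˢ X.partition.part j).indicator X.graphon.toFun

/-- The coloured analogue of the cut norm distance. -/
def cutNormDist (X Y : ColouredGraphon k) : ℝ :=
  sSup {r : ℝ | ∃ C D : Set I, NullMeasurableSet C (volume : Measure I) ∧
      NullMeasurableSet D (volume : Measure I) ∧
      r = ∑ i, ∑ j, |∫ z in C ×ˢ D, (X.block i j z - Y.block i j z)|} +
    ∑ i, (volume : Measure I).real (symmDiff (X.partition.part i) (Y.partition.part i))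

/-- The cut distance of coloured graphons. -/
def cutDist (X Y : ColouredGraphon k) : ℝ :=
  sInf {r : ℝ | ∃ φ ψ : MeasurePreservingMap, r = cutNormDist (X.pullback φ) (Y.pullback ψ)}

end ColouredGraphon

/-- Coloured graphons, with those at cut distance `0` identified. -/
def ColouredGraphonSpace (k : ℕ) : Type :=
  Quot fun X Y : ColouredGraphon k => X.cutDist Y = 0

/-- The class of a coloured graphon. -/
def ColouredGraphon.toSpace {k : ℕ} (X : ColouredGraphon k) : ColouredGraphonSpace k :=
  Quot.mk _ X

end

/-! Everything rests on one lifting principle: if two Borel maps `g`, `q` on `[0,1]` have the same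
law, then sampling from the conditional law of `x` given `g x` yields a measure-preserving `φ` on
the square with `g ∘ φ = q ∘ fst` almost everywhere (`exists_measurePreserving_lift`).

Metric: lifting over the identity gives any two measure-preserving maps a common refinement. Pulling
back does not increase `cutNormDist`, because the pushforward of Lebesgue measure on a set has
density at most 1, and a bilinear form over such densities is bounded by its values on indicators.
Together these give the triangle inequality for `cutDist`.

Compactness: weak regularity approximates each graphon, to every accuracy `1/(l+1)`, by a
combination of boundedly many rectangles. All their sides and all colour classes form a countable
family, coded by a map into the Cantor set. Replacing the code by the quantile function of its law,
Helly selection gives a subsequence converging almost everywhere, and lifting turns this into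
rearrangements under which every set of the family is almost everywhere eventually constant
(`exists_rearrangement`). The step kernels then converge in `L¹`, the rearranged graphons converge
weakly in `L²` along a further subsequence, and the uniform approximation upgrades weak convergence
to cut norm convergence. -/

noncomputable section

/-! ### Measure-preserving lifts and quantile functions -/

open ProbabilityTheory Filter Topology in
-- The second coordinate of the square is the randomness used to sample from the conditional law of
-- `x` given `g x`; then `(q t, φ (t, u))` has the same joint law as `(g x, x)`.
theorem exists_measurePreserving_lift {g q : I → I} (hg : Measurable g) (hq : Measurable q)
    (h : (volume : Measure I).map g = (volume : Measure I).map q) :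
    ∃ φ : I × I → I, MeasurePreserving φ ∧ ∀ᵐ z : I × I, g (φ z) = q z.1 := by
  obtain ⟨f, hf, hfκ⟩ := Kernel.exists_measurable_map_eq_unitInterval
    (condDistrib id g (volume : Measure I))
  have hφ : Measurable fun z : I × I => f (q z.1) z.2 :=
    hf.comp ((hq.comp measurable_fst).prodMk measurable_snd)
  have hm : Measurable fun z : I × I => (q z.1, f (q z.1) z.2) :=
    (hq.comp measurable_fst).prodMk hφ
  have hm' : Measurable fun x : I => (g x, x) := hg.prodMk measurable_id
  have hjoint : (volume : Measure (I × I)).map (fun z => (q z.1, f (q z.1) z.2)) =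
      (volume : Measure I).map (fun x => (g x, x)) := by
    have h1 := compProd_map_condDistrib (mβ := inferInstance) (X := g) (Y := id)
      (μ := (volume : Measure I)) aemeasurable_id
    simp only [id] at h1
    rw [← h1]
    refine Measure.ext_of_lintegral _ fun F hF => ?_
    rw [lintegral_map hF hm, Measure.lintegral_compProd hF, h,
      lintegral_map (hF.lintegral_kernel_prod_right') hq, Measure.volume_eq_prod,
      lintegral_prod (fun z : I × I => F (q z.1, f (q z.1) z.2)) (hF.comp hm).aemeasurable]
    refine lintegral_congr fun t => ?_
    rw [← hfκ, lintegral_map (f := fun x => F (q t, x)) (hF.comp measurable_prodMk_left)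
      hf.of_uncurry_left]
  refine ⟨_, ⟨hφ, ?_⟩, ?_⟩
  -- The second marginal of `hjoint` says that `φ` preserves measure.
  · have := congrArg (Measure.map Prod.snd) hjoint
    rw [Measure.map_map measurable_snd hm,
      Measure.map_map measurable_snd hm'] at this
    have h3 : Prod.snd ∘ (fun x : I => (g x, x)) = id := rfl
    rw [h3, Measure.map_id] at this
    exact this
  · have hE : MeasurableSet {p : I × I | g p.2 = p.1} :=
      measurableSet_eq_fun (hg.comp measurable_snd) measurable_fst
    have h4 : ∀ᵐ p ∂((volume : Measure I).map (fun x => (g x, x))), g p.2 = p.1 := by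
      rw [ae_map_iff hm'.aemeasurable hE]
      exact ae_of_all _ fun x => rfl
    rw [← hjoint, ae_map_iff hm.aemeasurable hE] at h4
    exact h4

/-- Turns lifts defined on the square back into self-maps of the interval. -/
theorem exists_measurePreserving_unitInterval_prod :
    ∃ θ : I → I × I, MeasurePreserving θ := by
  obtain ⟨f, hf, h⟩ := (volume : Measure (I × I)).exists_measurable_map_eq
  exact ⟨f, hf, h⟩

/-- A monotone (quantile) function with a prescribed law. -/
theorem exists_monotone_map_eq (μ : Measure I) [IsProbabilityMeasure μ] :
    ∃ q : I → I, Monotone q ∧ (volume : Measure I).map q = μ := by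
  let q : I → I := fun t => sInf {x | t ≤ μ.real (Set.Iic x)}
  have hmono : Monotone q := fun s t hst =>
    sInf_le_sInf fun x (hx : (t : ℝ) ≤ _) => le_trans (Subtype.coe_le_coe.2 hst) hx
  refine ⟨q, hmono, ?_⟩
  have : IsProbabilityMeasure ((volume : Measure I).map q) :=
    Measure.isProbabilityMeasure_map hmono.measurable.aemeasurable
  refine Measure.ext_of_Iic _ _ fun x => ?_
  have hle : ∀ t : I, q t ≤ x ↔ (t : ℝ) ≤ μ.real (Set.Iic x) := by
    intro t
    refine ⟨fun h => ?_, fun h => sInf_le h⟩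
    have hne : {x : I | (t : ℝ) ≤ μ.real (Set.Iic x)}.Nonempty := by
      refine ⟨1, ?_⟩
      have : Set.Iic (1 : I) = Set.univ := by ext y; simp [unitInterval.le_one']
      simp [this, t.2.2]
    -- The infimum is attained, by right continuity of the distribution function along a sequence
    -- decreasing to it.
    obtain ⟨u, hu, hut, huS⟩ := exists_seq_tendsto_sInf hne (OrderBot.bddBelow _)
    have hInter : ⋂ n, Set.Iic (u n) = Set.Iic (q t) := by
      ext y
      simp only [Set.mem_iInter, Set.mem_Iic]
      exact ⟨fun hy => ge_of_tendsto' hut hy, fun hy n => hy.trans (sInf_le (huS n))⟩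
    have hlim : Filter.Tendsto (fun n => μ.real (Set.Iic (u n))) Filter.atTop
        (nhds (μ.real (Set.Iic (q t)))) := by
      rw [← hInter]
      refine (ENNReal.tendsto_toReal (measure_ne_top _ _)).comp ?_
      exact tendsto_measure_iInter_atTop (fun n => measurableSet_Iic.nullMeasurableSet)
        (fun m n hmn => Set.Iic_subset_Iic.2 (hu hmn)) ⟨0, measure_ne_top _ _⟩
    exact (ge_of_tendsto' hlim huS).trans (measureReal_mono (Set.Iic_subset_Iic.2 h))
  rw [Measure.map_apply hmono.measurable measurableSet_Iic]
  have hI : μ.real (Set.Iic x) ∈ I := ⟨measureReal_nonneg, measureReal_le_one⟩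
  have : q ⁻¹' Set.Iic x = Set.Iic (⟨μ.real (Set.Iic x), hI⟩ : I) := by
    ext t; exact hle t
  rw [this, unitInterval.volume_Iic, ofReal_measureReal]

/-! ### Helly selection and simultaneous rearrangement -/

open Filter Topology in
/-- Helly's selection theorem for monotone self-maps of `[0,1]`. -/
theorem exists_subseq_tendsto_ae_of_monotone (q : ℕ → I → I) (hq : ∀ n, Monotone (q n)) :
    ∃ s : ℕ → ℕ, StrictMono s ∧
      ∀ᵐ t : I, ∃ l, Tendsto (fun n => q (s n) t) atTop (𝓝 l) := by
  -- A diagonal argument in disguise: compactness of a countable power of `I` gives convergence at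
  -- all points of a dense sequence.
  obtain ⟨a, s, hs, ha⟩ := CompactSpace.tendsto_subseq
    (fun n (i : ℕ) => q n (TopologicalSpace.denseSeq I i))
  refine ⟨s, hs, ?_⟩
  rw [tendsto_pi_nhds] at ha
  let L : I → I := fun t => limsup (fun n => q (s n) t) atTop
  have hL : Monotone L := fun x y hxy =>
    limsup_le_limsup (Eventually.of_forall fun n => hq (s n) hxy)
  have key : ∀ x y : I, x < y → L x ≤ liminf (fun n => q (s n) y) atTop := by
    intro x y hxy
    obtain ⟨i, hi⟩ := (TopologicalSpace.denseRange_denseSeq I).exists_mem_open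
      isOpen_Ioo (Set.nonempty_Ioo.2 hxy)
    calc L x ≤ L (TopologicalSpace.denseSeq I i) := hL hi.1.le
      _ = liminf (fun n => q (s n) (TopologicalSpace.denseSeq I i)) atTop :=
        (ha i).limsup_eq.trans (ha i).liminf_eq.symm
      _ ≤ liminf (fun n => q (s n) y) atTop :=
        liminf_le_liminf (Eventually.of_forall fun n => hq (s n) hi.2.le)
  -- The point 0 has no left neighbours, and `key` is applied from the left of a continuity point of
  -- `L`.
  have h0 : ∀ᵐ t : I, t ≠ 0 := by
    simp [ae_iff]
  have hc : ∀ᵐ t : I, ContinuousAt L t := by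
    rw [ae_iff]; exact hL.countable_not_continuousAt.measure_zero _
  filter_upwards [h0, hc] with t ht hct
  refine ⟨L t, tendsto_of_le_liminf_of_limsup_le ?_ le_rfl⟩
  have : (𝓝[<] t).NeBot := nhdsLT_neBot_of_exists_lt ⟨0, unitInterval.pos_iff_ne_zero.2 ht⟩
  refine le_of_tendsto (hct.tendsto.mono_left (nhdsWithin_le_nhds (s := Set.Iio t))) ?_
  filter_upwards [self_mem_nhdsWithin] with x hx using key x t hx

/-- A topological embedding of the Cantor space into `[0,1]`. -/
def cantorEmbedding (b : ℕ → Bool) : I :=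
  ⟨cantorSetHomeomorphNatToBool.symm b,
    cantorSet_subset_unitInterval (cantorSetHomeomorphNatToBool.symm b).2⟩

theorem continuous_cantorEmbedding : Continuous cantorEmbedding :=
  (continuous_subtype_val.comp cantorSetHomeomorphNatToBool.symm.continuous).subtype_mk _

theorem isClosedEmbedding_cantorEmbedding : Topology.IsClosedEmbedding cantorEmbedding :=
  continuous_cantorEmbedding.isClosedEmbedding fun _ _ h =>
    cantorSetHomeomorphNatToBool.symm.injective (Subtype.ext (congrArg (fun x : I => (x : ℝ)) h))

open Filter Topology in
-- The order of `I` serves Helly selection, the product topology of the Cantor space serves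
-- coordinatewise convergence; the closed image ensures that the limit is again a code.
theorem exists_tendsto_of_tendsto_cantorEmbedding {b : ℕ → ℕ → Bool} {l : I}
    (h : Tendsto (fun n => cantorEmbedding (b n)) atTop (𝓝 l)) :
    ∃ c, Tendsto b atTop (𝓝 c) := by
  obtain ⟨c, rfl⟩ := isClosedEmbedding_cantorEmbedding.isClosed_range.mem_of_tendsto h
    (Eventually.of_forall fun n => Set.mem_range_self _)
  exact ⟨c, isClosedEmbedding_cantorEmbedding.isInducing.tendsto_nhds_iff.2 h⟩

open Filter Topology in
/-- Simultaneous rearrangement: after passing to a subsequence, countably many sequences of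
subsets of `[0,1]` converge when pulled back along suitable measure-preserving maps. -/
theorem exists_rearrangement {J : Type*} [Countable J] (S : ℕ → J → Set I)
    (hS : ∀ n j, MeasurableSet (S n j)) :
    ∃ (s : ℕ → ℕ) (φ : ℕ → I → I) (B : J → Set I), StrictMono s ∧
      (∀ n, MeasurePreserving (φ n)) ∧ (∀ j, MeasurableSet (B j)) ∧
      ∀ j, ∀ᵐ t : I, ∀ᶠ n in atTop, (φ n t ∈ S (s n) j ↔ t ∈ B j) := by
  classical
  obtain ⟨e, he⟩ := exists_injective_nat J
  -- The code of `x` lists the sets of the family containing `x`; coordinates outside the range of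
  -- `e` are `false`.
  let b : ℕ → I → ℕ → Bool := fun n x i => decide (∃ j, e j = i ∧ x ∈ S n j)
  have hb : ∀ n x j, b n x (e j) = true ↔ x ∈ S n j := by
    intro n x j
    simp only [b, decide_eq_true_eq]
    exact ⟨fun ⟨j', h, hx⟩ => he h ▸ hx, fun hx => ⟨j, rfl, hx⟩⟩
  have hbm : ∀ n, Measurable (b n) := by
    intro n
    refine measurable_pi_lambda _ fun i => measurable_to_bool ?_
    have : (fun x => b n x i) ⁻¹' {true} = ⋃ j, {x | e j = i ∧ x ∈ S n j} := by
      ext x; simp [b]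
    rw [this]
    refine MeasurableSet.iUnion fun j => ?_
    exact (MeasurableSet.const (e j = i)).inter (hS n j)
  let g : ℕ → I → I := fun n x => cantorEmbedding (b n x)
  have hg : ∀ n, Measurable (g n) := fun n => continuous_cantorEmbedding.measurable.comp (hbm n)
  have hμ : ∀ n, IsProbabilityMeasure ((volume : Measure I).map (g n)) := fun n =>
    Measure.isProbabilityMeasure_map (hg n).aemeasurable
  choose q hq hqg using fun n => exists_monotone_map_eq ((volume : Measure I).map (g n))
  obtain ⟨s, hs, hlim⟩ := exists_subseq_tendsto_ae_of_monotone q hq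
  choose φ hφ hφg using fun n =>
    exists_measurePreserving_lift (hg n) (hq n).measurable (hqg n).symm
  obtain ⟨θ, hθ⟩ := exists_measurePreserving_unitInterval_prod
  have hψ : ∀ n, MeasurePreserving (φ (s n) ∘ θ) := fun n => (hφ (s n)).comp hθ
  refine ⟨s, fun n => φ (s n) ∘ θ, fun j => {t | ∀ᶠ n in atTop, φ (s n) (θ t) ∈ S (s n) j}, hs,
    hψ, fun j => ?_, fun j => ?_⟩
  · have : {t | ∀ᶠ n in atTop, φ (s n) (θ t) ∈ S (s n) j} =
        liminf (fun n => (φ (s n) ∘ θ) ⁻¹' S (s n) j) atTop := by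
      ext t
      simp [mem_liminf_iff_eventually_mem]
    simp only [this]
    exact MeasurableSet.measurableSet_liminf fun n => (hψ n).measurable (hS _ _)
  · have h1 : ∀ᵐ t : I, ∃ l, Tendsto (fun n => q (s n) (θ t).1) atTop (𝓝 l) :=
      (Measure.quasiMeasurePreserving_fst.comp hθ.quasiMeasurePreserving).ae hlim
    have h2 : ∀ᵐ t : I, ∀ n, g (s n) (φ (s n) (θ t)) = q (s n) (θ t).1 :=
      ae_all_iff.2 fun n => hθ.quasiMeasurePreserving.ae (hφg (s n))
    filter_upwards [h1, h2] with t ⟨l, hl⟩ ht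
    obtain ⟨c, hc⟩ := exists_tendsto_of_tendsto_cantorEmbedding
      (b := fun n => b (s n) (φ (s n) (θ t))) (hl.congr fun n => (ht n).symm)
    -- Each coordinate lives in a discrete space, so its convergence means that it is eventually
    -- constant.
    have hcj := (tendsto_pi_nhds.1 hc (e j)).eventually
      ((isOpen_discrete {c (e j)}).mem_nhds rfl)
    have key : ∀ᶠ n in atTop, (φ (s n) (θ t) ∈ S (s n) j ↔ c (e j) = true) := by
      filter_upwards [hcj] with n hn
      rw [← hb, show b (s n) (φ (s n) (θ t)) (e j) = c (e j) from hn]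
    have hB : (∀ᶠ n in atTop, φ (s n) (θ t) ∈ S (s n) j) ↔ c (e j) = true := by
      rw [eventually_congr key, eventually_const]
    filter_upwards [key] with n hn
    exact hn.trans hB.symm

/-! ### Weak regularity -/

/-- A signed sum of `2 n` rectangles with weights `± ε`. -/
def stepKernel (ε : ℝ) (n : ℕ) (S T S' T' : ℕ → Set I) (z : I × I) : ℝ :=
  ε * ∑ i ∈ Finset.range n,
    ((S i ×ˢ T i).indicator 1 z - (S' i ×ˢ T' i).indicator (1 : I × I → ℝ) z)

/-- The energy change in one regularity step: with `c = ± ε` of the right sign and a rectangle of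
discrepancy above `ε`, the energy drops by at least `ε ^ 2`. -/
theorem integral_sub_indicator_sq {Ω : Type*} [MeasurableSpace Ω] {μ : Measure Ω}
    [IsFiniteMeasure μ] {R : Ω → ℝ} (hR : MemLp R 2 μ) (c : ℝ) {E : Set Ω} (hE : MeasurableSet E) :
    ∫ z, (R z - c * E.indicator 1 z) ^ 2 ∂μ =
      ∫ z, R z ^ 2 ∂μ - 2 * c * ∫ z in E, R z ∂μ + c ^ 2 * μ.real E := by
  have h1 : ∀ z, (R z - c * E.indicator 1 z) ^ 2 =
      R z ^ 2 - 2 * c * E.indicator R z + c ^ 2 * E.indicator (1 : Ω → ℝ) z := by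
    intro z
    by_cases hz : z ∈ E
    · simp [hz]; ring
    · simp [hz]
  have hi : Integrable (E.indicator R) μ := (hR.integrable (by norm_num)).indicator hE
  have hi' : Integrable (E.indicator (1 : Ω → ℝ)) μ :=
    (integrable_const (1 : ℝ)).indicator hE
  have hs : Integrable (fun z => R z ^ 2 - 2 * c * E.indicator R z) μ :=
    hR.integrable_sq.sub (hi.const_mul _)
  simp_rw [h1]
  rw [integral_add hs (hi'.const_mul _),
    integral_sub hR.integrable_sq (hi.const_mul _), integral_const_mul, integral_const_mul,
    integral_indicator hE, integral_indicator_one hE]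

theorem stepKernel_update (ε : ℝ) (n : ℕ) (S T S' T' : ℕ → Set I) (C D C' D' : Set I) (z : I × I) :
    stepKernel ε (n + 1) (Function.update S n C) (Function.update T n D)
        (Function.update S' n C') (Function.update T' n D') z =
      stepKernel ε n S T S' T' z +
        ε * ((C ×ˢ D).indicator 1 z - (C' ×ˢ D').indicator (1 : I × I → ℝ) z) := by
  simp only [stepKernel, Finset.sum_range_succ, Function.update_self, mul_add]
  congr 2
  refine Finset.sum_congr rfl fun i hi => ?_
  have : i ≠ n := (Finset.mem_range.1 hi).ne
  simp [Function.update_of_ne this]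

/-- The weak (Frieze–Kannan) regularity lemma for kernels, by energy decrement. -/
theorem exists_stepKernel_approx {ε : ℝ} (hε : 0 < ε) (n : ℕ) :
    ∀ R : I × I → ℝ, MemLp R 2 volume → ∫ z, R z ^ 2 ≤ n * ε ^ 2 →
      ∃ S T S' T' : ℕ → Set I, (∀ i, MeasurableSet (S i)) ∧ (∀ i, MeasurableSet (T i)) ∧
        (∀ i, MeasurableSet (S' i)) ∧ (∀ i, MeasurableSet (T' i)) ∧
        ∀ C D : Set I, MeasurableSet C → MeasurableSet D →
          |∫ z in C ×ˢ D, (R z - stepKernel ε n S T S' T' z)| ≤ ε := by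
  induction n with
  | zero =>
    intro R hR h0
    refine ⟨fun _ => ∅, fun _ => ∅, fun _ => ∅, fun _ => ∅, by simp, by simp, by simp, by simp,
      fun C D _ _ => ?_⟩
    have h1 : ∫ z, R z ^ 2 = 0 :=
      le_antisymm (by simpa using h0) (integral_nonneg fun z => sq_nonneg _)
    have h2 : R =ᵐ[volume] 0 := by
      have := (integral_eq_zero_iff_of_nonneg (fun z => sq_nonneg (R z)) hR.integrable_sq).1 h1
      filter_upwards [this] with z hz
      simpa using hz
    have h3 : ∫ z in C ×ˢ D, (R z - stepKernel ε 0 (fun _ => ∅) (fun _ => ∅) (fun _ => ∅)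
        (fun _ => ∅) z) = 0 := by
      refine integral_eq_zero_of_ae (ae_restrict_of_ae ?_)
      filter_upwards [h2] with z hz
      simp [stepKernel, hz]
    rw [h3, abs_zero]
    exact hε.le
  | succ n ih =>
    intro R hR hn
    by_cases hgood : ∀ C D : Set I, MeasurableSet C → MeasurableSet D → |∫ z in C ×ˢ D, R z| ≤ ε
    -- No bad rectangle remains, so the zero kernel, built from empty rectangles, is good enough.
    · refine ⟨fun _ => ∅, fun _ => ∅, fun _ => ∅, fun _ => ∅, by simp, by simp, by simp, by simp,
        fun C D hC hD => ?_⟩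
      simpa [stepKernel] using hgood C D hC hD
    push Not at hgood
    obtain ⟨C, D, hC, hD, hCD⟩ := hgood
    have hE : MeasurableSet (C ×ˢ D) := hC.prod hD
    have hind : MemLp ((C ×ˢ D).indicator (1 : I × I → ℝ)) 2 volume :=
      memLp_indicator_const 2 hE (1 : ℝ) (Or.inr (measure_ne_top _ _))
    have hup : ∀ (S : ℕ → Set I) (X : Set I), (∀ i, MeasurableSet (S i)) → MeasurableSet X →
        ∀ i, MeasurableSet (Function.update S n X i) := by
      intro S X hS hX i
      by_cases h : i = n
      · subst h; simpa using hX
      · simpa [Function.update_of_ne h] using hS i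
    have step : ∀ c : ℝ, c ^ 2 = ε ^ 2 → ε ^ 2 ≤ c * ∫ z in C ×ˢ D, R z →
        ∫ z, (R z - c * (C ×ˢ D).indicator 1 z) ^ 2 ≤ n * ε ^ 2 := by
      intro c hc hcR
      rw [integral_sub_indicator_sq hR c hE]
      have hv : (volume : Measure (I × I)).real (C ×ˢ D) ≤ 1 := measureReal_le_one
      push_cast at hn
      nlinarith [sq_nonneg ε]
    rcases lt_abs.1 hCD with hpos | hneg
    -- The bad rectangle enters with the sign of its integral; the slot of the opposite sign is
    -- filled with an empty rectangle.
    · obtain ⟨S, T, S', T', hS, hT, hS', hT', H⟩ := ih _ (hR.sub (hind.const_mul ε))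
        (step ε rfl (by nlinarith))
      refine ⟨_, _, _, _, hup S C hS hC, hup T D hT hD, hup S' ∅ hS' MeasurableSet.empty,
        hup T' ∅ hT' MeasurableSet.empty, fun C' D' hC' hD' => ?_⟩
      convert H C' D' hC' hD' using 3
      ext z
      rw [stepKernel_update]
      simp
      ring
    · obtain ⟨S, T, S', T', hS, hT, hS', hT', H⟩ := ih _ (hR.sub (hind.const_mul (-ε)))
        (step (-ε) (by ring) (by nlinarith))
      refine ⟨_, _, _, _, hup S ∅ hS MeasurableSet.empty, hup T ∅ hT MeasurableSet.empty,
        hup S' C hS' hC, hup T' D hT' hD, fun C' D' hC' hD' => ?_⟩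
      convert H C' D' hC' hD' using 3
      ext z
      rw [stepKernel_update]
      simp
      ring

/-! ### Rectangle integrals under measure-preserving maps -/

/-- A linear functional over densities between 0 and 1 is maximised by the indicator of the set
where the integrand is positive. -/
theorem exists_setIntegral_ge {Ω : Type*} [MeasurableSpace Ω] {μ ν : Measure Ω} (hν : ν ≤ μ)
    {h : Ω → ℝ} (hh : Integrable h μ) :
    ∃ C, MeasurableSet C ∧ ∫ x, h x ∂ν ≤ ∫ x in C, h x ∂μ := by
  obtain ⟨h', hm, hae⟩ := hh.aestronglyMeasurable
  have hC : MeasurableSet {x | 0 < h' x} := measurableSet_lt measurable_const hm.measurable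
  have hae' : h =ᵐ[ν] h' := (Measure.absolutelyContinuous_of_le hν).ae_eq hae
  have hh' : Integrable h' μ := hh.congr hae
  refine ⟨_, hC, ?_⟩
  calc ∫ x, h x ∂ν = ∫ x, h' x ∂ν := integral_congr_ae hae'
    _ ≤ ∫ x, {x | 0 < h' x}.indicator h' x ∂ν := by
      refine integral_mono (hh'.mono_measure hν) ((hh'.mono_measure hν).indicator hC) fun x => ?_
      by_cases hx : 0 < h' x
      · simp [hx]
      · simpa [hx] using not_lt.1 hx
    _ ≤ ∫ x, {x | 0 < h' x}.indicator h' x ∂μ := by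
      refine integral_mono_measure hν (ae_of_all _ fun x => ?_) (hh'.indicator hC)
      exact Set.indicator_nonneg (fun x hx => le_of_lt hx) x
    _ = ∫ x in {x | 0 < h' x}, h' x ∂μ := integral_indicator hC
    _ = ∫ x in {x | 0 < h' x}, h x ∂μ := (integral_congr_ae (ae_restrict_of_ae hae)).symm

/-- With one factor fixed the integral is linear in the other, so the two measures can be replaced
by restrictions one at a time. -/
theorem exists_setIntegral_prod_ge {ν ν' : Measure I} (hν : ν ≤ volume) (hν' : ν' ≤ volume)
    {F : I × I → ℝ} (hF : Integrable F volume) :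
    ∃ C D : Set I, MeasurableSet C ∧ MeasurableSet D ∧
      ∫ z, F z ∂(ν.prod ν') ≤ ∫ z in C ×ˢ D, F z := by
  have : IsFiniteMeasure ν := isFiniteMeasure_of_le _ hν
  have : IsFiniteMeasure ν' := isFiniteMeasure_of_le _ hν'
  have hF1 : Integrable F ((volume : Measure I).prod ν') :=
    hF.mono_measure (Measure.prod_mono le_rfl hν')
  have hF2 : Integrable F (ν.prod ν') := hF.mono_measure (Measure.prod_mono hν hν')
  obtain ⟨C, hC, hCle⟩ := exists_setIntegral_ge hν hF1.integral_prod_left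
  have hres : (volume : Measure I).restrict C ≤ volume := Measure.restrict_le_self
  have hF3 : Integrable F (((volume : Measure I).restrict C).prod volume) :=
    hF.mono_measure (Measure.prod_mono hres le_rfl)
  have hF4 : Integrable F (((volume : Measure I).restrict C).prod ν') :=
    hF.mono_measure (Measure.prod_mono hres hν')
  obtain ⟨D, hD, hDle⟩ := exists_setIntegral_ge hν' hF3.integral_prod_right
  refine ⟨C, D, hC, hD, ?_⟩
  rw [integral_prod _ hF2]
  refine hCle.trans ?_
  rw [← integral_prod _ hF4, integral_prod_symm _ hF4]
  refine hDle.trans (le_of_eq ?_)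
  rw [Measure.volume_eq_prod, ← Measure.prod_restrict, integral_prod_symm]
  exact hF.mono_measure (Measure.prod_mono hres Measure.restrict_le_self)

/-- Pulling back along a measure-preserving map does not increase integrals over rectangles. -/
theorem exists_setIntegral_pullback_le {φ : I → I} (hφ : MeasurePreserving φ) {C D : Set I}
    {F : I × I → ℝ} (hF : Integrable F volume) :
    ∃ C' D' : Set I, MeasurableSet C' ∧ MeasurableSet D' ∧
      ∫ z in C ×ˢ D, F (φ z.1, φ z.2) ≤ ∫ z in C' ×ˢ D', F z := by
  -- The pushforward of Lebesgue measure on `C` need not be a restriction, but it is dominated by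
  -- Lebesgue measure.
  have hle : ∀ C : Set I, ((volume : Measure I).restrict C).map φ ≤ volume := fun C =>
    (Measure.map_mono Measure.restrict_le_self hφ.measurable).trans_eq hφ.map_eq
  obtain ⟨C', D', hC', hD', h⟩ := exists_setIntegral_prod_ge (hle C) (hle D) hF
  refine ⟨C', D', hC', hD', le_of_eq_of_le ?_ h⟩
  have hmap : (((volume : Measure I).restrict C).map φ).prod
      (((volume : Measure I).restrict D).map φ) =
      ((volume : Measure (I × I)).restrict (C ×ˢ D)).map (Prod.map φ φ) := by
    rw [Measure.map_prod_map _ _ hφ.measurable hφ.measurable, Measure.prod_restrict,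
      ← Measure.volume_eq_prod]
  rw [hmap, integral_map (hφ.measurable.prodMap hφ.measurable).aemeasurable]
  · rfl
  · rw [← hmap]
    exact hF.aestronglyMeasurable.mono_measure (Measure.prod_mono (hle C) (hle D))

theorem abs_setIntegral_pullback_le {φ : I → I} (hφ : MeasurePreserving φ) {F : I × I → ℝ}
    (hF : Integrable F volume) {ε : ℝ} (h : ∀ C D : Set I, MeasurableSet C → MeasurableSet D →
      |∫ z in C ×ˢ D, F z| ≤ ε) (C D : Set I) :
    |∫ z in C ×ˢ D, F (φ z.1, φ z.2)| ≤ ε := by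
  refine abs_le'.2 ⟨?_, ?_⟩
  · obtain ⟨C', D', hC', hD', hle⟩ := exists_setIntegral_pullback_le hφ (C := C) (D := D) hF
    exact hle.trans ((le_abs_self _).trans (h C' D' hC' hD'))
  · obtain ⟨C', D', hC', hD', hle⟩ := exists_setIntegral_pullback_le hφ (C := C) (D := D) hF.neg
    simp only [Pi.neg_apply, integral_neg] at hle
    exact hle.trans ((neg_le_abs _).trans (h C' D' hC' hD'))

/-! ### Weak limits and their upgrade to cut norm limits -/

open Filter Topology in
/-- Sequential weak compactness of bounded sequences in `L²`. -/
theorem exists_weak_subseq_limit {Ω : Type*} [MeasurableSpace Ω] {μ : Measure Ω}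
    [IsFiniteMeasure μ] [IsSeparable μ] (V : ℕ → Ω → ℝ)
    (hV : ∀ n, AEStronglyMeasurable (V n) μ) (hb : ∀ n z, ‖V n z‖ ≤ 1) :
    ∃ (s : ℕ → ℕ) (w : Ω → ℝ), StrictMono s ∧ Measurable w ∧ Integrable w μ ∧
      ∀ E, MeasurableSet E →
        Tendsto (fun n => ∫ z in E, V (s n) z ∂μ) atTop (𝓝 (∫ z in E, w z ∂μ)) := by
  have hL : ∀ n, MemLp (V n) 2 μ := fun n => MemLp.of_bound (hV n) 1 (ae_of_all _ (hb n))
  let v : ℕ → Lp ℝ 2 μ := fun n => (hL n).toLp (V n)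
  have hvn : ∀ n, ‖v n‖ ≤ (measureUnivNNReal μ : ℝ) ^ (2 : ENNReal).toReal⁻¹ * 1 := fun n =>
    Lp.norm_le_of_ae_bound zero_le_one <| by
      filter_upwards [(hL n).coeFn_toLp] with z hz
      rw [hz]
      exact hb n z
  -- Riesz representation places the functions in a closed ball of the dual, where Banach–Alaoglu
  -- with separability of `L²` gives sequential compactness.
  have hmem : ∀ n, StrongDual.toWeakDual (InnerProductSpace.toDual ℝ _ (v n)) ∈
      WeakDual.toStrongDual ⁻¹' Metric.closedBall (0 : StrongDual ℝ (Lp ℝ 2 μ))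
        ((measureUnivNNReal μ : ℝ) ^ (2 : ENNReal).toReal⁻¹ * 1) := by
    intro n
    simp only [Set.mem_preimage, mem_closedBall_zero_iff]
    refine le_of_eq_of_le ?_ (hvn n)
    exact (InnerProductSpace.toDual ℝ (Lp ℝ 2 μ)).norm_map (v n)
  have : Fact ((2 : ENNReal) ≠ ⊤) := ⟨by norm_num⟩
  obtain ⟨l, -, s, hs, hl⟩ := WeakDual.isSeqCompact_closedBall ℝ (Lp ℝ 2 μ) 0 _ hmem
  let w : Lp ℝ 2 μ := (InnerProductSpace.toDual ℝ _).symm (WeakDual.toStrongDual l)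
  refine ⟨s, w, hs, (Lp.stronglyMeasurable w).measurable, (Lp.memLp w).integrable (by norm_num),
    fun E hE => ?_⟩
  have h1 := ((WeakDual.eval_continuous (𝕜 := ℝ)
    (indicatorConstLp 2 hE (measure_ne_top μ E) (1 : ℝ))).tendsto l).comp hl
  have h2 : l (indicatorConstLp 2 hE (measure_ne_top μ E) (1 : ℝ)) = ∫ z in E, w z ∂μ := by
    rw [← L2.inner_indicatorConstLp_one (𝕜 := ℝ) hE (measure_ne_top μ E) w, real_inner_comm]
    exact (InnerProductSpace.toDual_symm_apply (𝕜 := ℝ)).symm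
  rw [h2] at h1
  refine h1.congr fun n => ?_
  have h3 : ∫ z in E, V (s n) z ∂μ = ∫ z in E, v (s n) z ∂μ :=
    (integral_congr_ae (ae_restrict_of_ae (hL (s n)).coeFn_toLp)).symm
  rw [h3, ← L2.inner_indicatorConstLp_one (𝕜 := ℝ) hE (measure_ne_top μ E), real_inner_comm]
  rfl

open Filter Topology in
/-- A sequence of graphons has a subsequence converging weakly to a graphon. -/
theorem exists_graphon_weak_subseq_limit (V : ℕ → Graphon) :
    ∃ (s : ℕ → ℕ) (W : Graphon), StrictMono s ∧ ∀ E, MeasurableSet E →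
      Tendsto (fun n => ∫ z in E, (V (s n)).toFun z) atTop (𝓝 (∫ z in E, W.toFun z)) := by
  have hm : ∀ n, AEStronglyMeasurable (V n).toFun (volume : Measure (I × I)) := fun n =>
    (V n).measurable.aemeasurable.aestronglyMeasurable
  have hb : ∀ n z, ‖(V n).toFun z‖ ≤ 1 := fun n z => by
    rw [Real.norm_of_nonneg ((V n).mem_Icc z).1]
    exact ((V n).mem_Icc z).2
  have hi : ∀ n, Integrable (V n).toFun (volume : Measure (I × I)) := fun n =>
    Integrable.of_bound (hm n) 1 (ae_of_all _ (hb n))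
  have : MeasurableSpace.CountablyGenerated I := countablyGenerated_of_standardBorel
  obtain ⟨s, w, hs, hw, hwi, hlim⟩ := exists_weak_subseq_limit (fun n => (V n).toFun) hm hb
  have h0 : 0 ≤ᵐ[volume] w := ae_nonneg_of_forall_setIntegral_nonneg hwi fun E hE _ =>
    ge_of_tendsto' (hlim E hE) fun n => integral_nonneg fun z => ((V (s n)).mem_Icc z).1
  have h1 : w ≤ᵐ[volume] fun _ => 1 :=
    ae_le_of_forall_setIntegral_le hwi (integrable_const _) fun E hE _ =>
      le_of_tendsto' (hlim E hE) fun n =>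
        integral_mono (hi _).integrableOn (integrable_const _) fun z => ((V (s n)).mem_Icc z).2
  have hswap : MeasurePreserving (Prod.swap : I × I → I × I) := Measure.measurePreserving_swap
  have hsymm : (fun z => w z.swap) =ᵐ[volume] w := by
    have hwi' : Integrable (fun z : I × I => w z.swap) volume :=
      hswap.integrable_comp_of_integrable hwi
    refine Integrable.ae_eq_of_forall_setIntegral_eq _ _ hwi' hwi fun E hE _ => ?_
    have hpre : ∀ f : I × I → ℝ, ∫ z in E, f z.swap = ∫ z in Prod.swap ⁻¹' E, f z := by
      intro f
      rw [← hswap.setIntegral_preimage_emb MeasurableEquiv.prodComm.measurableEmbedding]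
      rfl
    rw [hpre]
    refine tendsto_nhds_unique (hlim _ (measurable_swap hE)) ((hlim E hE).congr fun n => ?_)
    rw [← hpre]
    exact integral_congr_ae (ae_of_all _ fun z => (V (s n)).symm z.1 z.2)
  -- The weak limit is symmetric and `[0,1]`-valued only almost everywhere; symmetrising and
  -- clamping make this hold at every point.
  let W : I × I → ℝ := fun z => max 0 (min 1 ((w z + w z.swap) / 2))
  have hW : W =ᵐ[volume] w := by
    filter_upwards [h0, h1, hsymm] with z hz0 hz1 hzs
    have : (w z + w z.swap) / 2 = w z := by rw [hzs]; ring
    simp only [W, this, min_eq_right hz1]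
    exact max_eq_right hz0
  refine ⟨s, ⟨W, fun z => ⟨le_max_left _ _, max_le zero_le_one (min_le_left _ _)⟩, fun x y => ?_,
    (hw.aemeasurable.congr hW.symm).nullMeasurable⟩, hs, fun E hE => ?_⟩
  · simp only [W, Prod.swap_prod_mk, add_comm]
  · have := hlim E hE
    rwa [← integral_congr_ae (ae_restrict_of_ae hW)] at this

open Filter Topology in
/-- Weak convergence of kernels that are approximated in cut norm by `L¹`-convergent kernels is
convergence in cut norm. -/
theorem eventually_abs_setIntegral_sub_le {V : ℕ → I × I → ℝ} {W : I × I → ℝ}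
    (hV : ∀ n, Integrable (V n) volume) (hW : Integrable W volume)
    (hlim : ∀ E, MeasurableSet E → Tendsto (fun n => ∫ z in E, V n z) atTop (𝓝 (∫ z in E, W z)))
    (happ : ∀ ε > 0, ∃ (K : ℕ → I × I → ℝ) (L : I × I → ℝ), (∀ n, Integrable (K n) volume) ∧
      Integrable L volume ∧ Tendsto (fun n => ∫ z, |K n z - L z|) atTop (𝓝 0) ∧
      ∀ n, ∀ C D : Set I, MeasurableSet C → MeasurableSet D →
        |∫ z in C ×ˢ D, (V n z - K n z)| ≤ ε) {ε : ℝ} (hε : 0 < ε) :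
    ∀ᶠ n in atTop, ∀ C D : Set I, MeasurableSet C → MeasurableSet D →
      |∫ z in C ×ˢ D, (V n z - W z)| ≤ ε := by
  obtain ⟨K, L, hK, hL, hKL, hVK⟩ := happ (ε / 3) (by positivity)
  have hdiff : ∀ n (E : Set (I × I)), |∫ z in E, (K n z - L z)| ≤ ∫ z, |K n z - L z| := by
    intro n E
    refine abs_integral_le_integral_abs.trans ?_
    exact setIntegral_le_integral ((hK n).sub hL).abs (ae_of_all _ fun z => abs_nonneg _)
  -- On each fixed rectangle the bound for `V n - K n` passes to the limit. The resulting bound on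
  -- `L - W` does not depend on the rectangle, which is the source of uniformity.
  have hLW : ∀ C D : Set I, MeasurableSet C → MeasurableSet D →
      |∫ z in C ×ˢ D, (L z - W z)| ≤ ε / 3 := by
    intro C D hC hD
    have h1 : Tendsto (fun n => ∫ z in C ×ˢ D, (K n z - L z)) atTop (𝓝 0) :=
      squeeze_zero_norm (fun n => hdiff n _) hKL
    have h2 : Tendsto (fun n => ∫ z in C ×ˢ D, (V n z - K n z)) atTop
        (𝓝 (∫ z in C ×ˢ D, (W z - L z))) := by
      have h3 := ((hlim _ (hC.prod hD)).sub h1).sub_const (∫ z in C ×ˢ D, L z)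
      rw [sub_zero, ← integral_sub hW.integrableOn hL.integrableOn] at h3
      refine h3.congr fun n => ?_
      rw [integral_sub (hK n).integrableOn hL.integrableOn,
        integral_sub (hV n).integrableOn (hK n).integrableOn]
      ring
    have h4 : ∫ z in C ×ˢ D, (L z - W z) = -∫ z in C ×ˢ D, (W z - L z) := by
      rw [← integral_neg]; simp
    rw [h4, abs_neg]
    exact le_of_tendsto' h2.abs fun n => hVK n C D hC hD
  filter_upwards [hKL.eventually_le_const (show 0 < ε / 3 by positivity)] with n hn C D hC hD
  have h5 : ∫ z in C ×ˢ D, (V n z - W z) = (∫ z in C ×ˢ D, (V n z - K n z)) +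
      (∫ z in C ×ˢ D, (K n z - L z)) + ∫ z in C ×ˢ D, (L z - W z) := by
    rw [integral_sub (hK n).integrableOn hL.integrableOn,
        integral_sub (hV n).integrableOn (hK n).integrableOn,
        integral_sub (hV n).integrableOn hW.integrableOn,
        integral_sub hL.integrableOn hW.integrableOn]
    ring
  rw [h5]
  refine (abs_add_three _ _ _).trans ?_
  linarith [hVK n C D hC hD, hdiff n (C ×ˢ D), hLW C D hC hD]

/-! ### Measure-preserving maps up to null sets -/

namespace MeasurePreservingMap

def ofMeasurePreserving (f : I → I) (hf : MeasurePreserving f) : MeasurePreservingMap where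
  toFun := f
  measurable _ hX := hX.preimage hf.quasiMeasurePreserving
  volume_preimage _ hX := hf.measure_preimage hX

def comp (φ ψ : MeasurePreservingMap) : MeasurePreservingMap where
  toFun := φ.toFun ∘ ψ.toFun
  measurable X hX := ψ.measurable _ (φ.measurable X hX)
  volume_preimage X hX := by
    rw [Set.preimage_comp, ψ.volume_preimage _ (φ.measurable X hX), φ.volume_preimage X hX]

/-- Reduces arguments with pushforwards and lifts to Borel maps. -/
theorem exists_measurePreserving_ae_eq (φ : MeasurePreservingMap) :
    ∃ f : I → I, MeasurePreserving f ∧ φ.toFun =ᵐ[volume] f := by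
  have hφ : AEMeasurable φ.toFun (volume : Measure I) :=
    NullMeasurable.aemeasurable fun s hs => φ.measurable s hs.nullMeasurableSet
  refine ⟨hφ.mk φ.toFun, ⟨hφ.measurable_mk, ?_⟩, hφ.ae_eq_mk⟩
  ext s hs
  rw [Measure.map_apply hφ.measurable_mk hs, ← φ.volume_preimage s hs.nullMeasurableSet]
  refine measure_congr ?_
  filter_upwards [hφ.ae_eq_mk] with x hx
  exact congrArg s hx.symm

end MeasurePreservingMap

theorem ae_prod_of_ae_eq {f g : I → I} (h : f =ᵐ[volume] g) :
    ∀ᵐ z : I × I, f z.1 = g z.1 ∧ f z.2 = g z.2 := by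
  have h1 : ∀ᵐ z : I × I, f z.1 = g z.1 :=
    (Measure.quasiMeasurePreserving_fst (μ := (volume : Measure I)) (ν := volume)).ae h
  have h2 : ∀ᵐ z : I × I, f z.2 = g z.2 :=
    (Measure.quasiMeasurePreserving_snd (μ := (volume : Measure I)) (ν := volume)).ae h
  exact h1.and h2

theorem NullMeasurableSet.symmDiff_set {Ω : Type*} [MeasurableSpace Ω] {μ : Measure Ω}
    {A B : Set Ω} (hA : NullMeasurableSet A μ) (hB : NullMeasurableSet B μ) :
    NullMeasurableSet (symmDiff A B) μ :=
  (hA.diff hB).union (hB.diff hA)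

theorem measureReal_symmDiff_le {Ω : Type*} [MeasurableSpace Ω] (μ : Measure Ω)
    [IsFiniteMeasure μ] (A B C : Set Ω) :
    μ.real (symmDiff A C) ≤ μ.real (symmDiff A B) + μ.real (symmDiff B C) :=
  (measureReal_mono (symmDiff_triangle A B C)).trans (measureReal_union_le _ _)

/-! ### The cut distance as a pseudometric -/

namespace ColouredGraphon

variable {k : ℕ}

theorem nullMeasurable_block (X : ColouredGraphon k) (i j : Fin k) :
    NullMeasurable (X.block i j) (volume : Measure (I × I)) := by
  have h : NullMeasurableSet (X.partition.part i ×ˢ X.partition.part j)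
      (volume : Measure (I × I)) := (X.partition.measurable i).prod (X.partition.measurable j)
  exact (X.graphon.measurable.aemeasurable.indicator₀ h).nullMeasurable

theorem block_mem_Icc (X : ColouredGraphon k) (i j : Fin k) (z : I × I) :
    X.block i j z ∈ Set.Icc (0 : ℝ) 1 := by
  unfold block
  by_cases h : z ∈ X.partition.part i ×ˢ X.partition.part j
  · simpa [h] using X.graphon.mem_Icc z
  · simp [h]

theorem integrable_block (X : ColouredGraphon k) (i j : Fin k) :
    Integrable (X.block i j) (volume : Measure (I × I)) := by
  refine Integrable.of_bound (X.nullMeasurable_block i j).aemeasurable.aestronglyMeasurable 1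
    (ae_of_all _ fun z => ?_)
  rw [Real.norm_of_nonneg (X.block_mem_Icc i j z).1]
  exact (X.block_mem_Icc i j z).2

theorem block_pullback (X : ColouredGraphon k) (φ : MeasurePreservingMap) (i j : Fin k)
    (z : I × I) : (X.pullback φ).block i j z = X.block i j (φ.toFun z.1, φ.toFun z.2) :=
  rfl

/-- The cut discrepancy of two coloured graphons on the rectangle `C × D`. -/
def discrepancy (X Y : ColouredGraphon k) (C D : Set I) : ℝ :=
  ∑ i, ∑ j, |∫ z in C ×ˢ D, (X.block i j z - Y.block i j z)|

/-- The distance between the colour classes of two coloured graphons. -/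
def colourDist (X Y : ColouredGraphon k) : ℝ :=
  ∑ i, (volume : Measure I).real (symmDiff (X.partition.part i) (Y.partition.part i))

theorem discrepancy_nonneg (X Y : ColouredGraphon k) (C D : Set I) : 0 ≤ X.discrepancy Y C D :=
  Finset.sum_nonneg fun _ _ => Finset.sum_nonneg fun _ _ => abs_nonneg _

theorem colourDist_nonneg (X Y : ColouredGraphon k) : 0 ≤ X.colourDist Y :=
  Finset.sum_nonneg fun _ _ => measureReal_nonneg

theorem discrepancy_comm (X Y : ColouredGraphon k) (C D : Set I) :
    X.discrepancy Y C D = Y.discrepancy X C D := by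
  unfold discrepancy
  refine Finset.sum_congr rfl fun i _ => Finset.sum_congr rfl fun j _ => ?_
  rw [← abs_neg, ← integral_neg]
  simp

theorem colourDist_comm (X Y : ColouredGraphon k) : X.colourDist Y = Y.colourDist X := by
  simp only [colourDist, symmDiff_comm]

theorem discrepancy_triangle (X Y Z : ColouredGraphon k) (C D : Set I) :
    X.discrepancy Z C D ≤ X.discrepancy Y C D + Y.discrepancy Z C D := by
  simp only [discrepancy, ← Finset.sum_add_distrib]
  refine Finset.sum_le_sum fun i _ => Finset.sum_le_sum fun j _ => ?_
  refine le_of_eq_of_le (congrArg _ ?_) (abs_add_le _ _)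
  rw [integral_sub (X.integrable_block i j).integrableOn (Z.integrable_block i j).integrableOn,
    integral_sub (X.integrable_block i j).integrableOn (Y.integrable_block i j).integrableOn,
    integral_sub (Y.integrable_block i j).integrableOn (Z.integrable_block i j).integrableOn]
  ring

theorem colourDist_triangle (X Y Z : ColouredGraphon k) :
    X.colourDist Z ≤ X.colourDist Y + Y.colourDist Z := by
  simp only [colourDist, ← Finset.sum_add_distrib]
  exact Finset.sum_le_sum fun i _ => measureReal_symmDiff_le _ _ _ _

theorem discrepancy_le (X Y : ColouredGraphon k) (C D : Set I) :
    X.discrepancy Y C D ≤ ∑ i, ∑ j, ∫ z, |X.block i j z - Y.block i j z| :=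
  Finset.sum_le_sum fun i _ => Finset.sum_le_sum fun j _ => abs_integral_le_integral_abs.trans <|
    setIntegral_le_integral ((X.integrable_block i j).sub (Y.integrable_block i j)).abs
      (ae_of_all _ fun _ => abs_nonneg _)

theorem discrepancy_add_colourDist_le (X Y : ColouredGraphon k) {C D : Set I}
    (hC : NullMeasurableSet C (volume : Measure I))
    (hD : NullMeasurableSet D (volume : Measure I)) :
    X.discrepancy Y C D + X.colourDist Y ≤ X.cutNormDist Y := by
  refine add_le_add (le_csSup ?_ ⟨C, D, hC, hD, rfl⟩) le_rfl
  refine ⟨∑ i, ∑ j, ∫ z, |X.block i j z - Y.block i j z|, ?_⟩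
  rintro r ⟨C, D, -, -, rfl⟩
  exact X.discrepancy_le Y C D

/-- Borel rectangles suffice, since Lebesgue measurable sets agree with Borel sets up to null sets.
-/
theorem cutNormDist_le {X Y : ColouredGraphon k} {r : ℝ}
    (h : ∀ C D : Set I, MeasurableSet C → MeasurableSet D →
      X.discrepancy Y C D + X.colourDist Y ≤ r) : X.cutNormDist Y ≤ r := by
  rw [cutNormDist, ← le_sub_iff_add_le]
  refine csSup_le ⟨_, ∅, ∅, nullMeasurableSet_empty, nullMeasurableSet_empty, rfl⟩ ?_
  rintro r ⟨C, D, hC, hD, rfl⟩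
  rw [le_sub_iff_add_le]
  obtain ⟨C', -, hC', hCC'⟩ := hC.exists_measurable_superset_ae_eq
  obtain ⟨D', -, hD', hDD'⟩ := hD.exists_measurable_superset_ae_eq
  refine le_of_eq_of_le (congrArg₂ _ ?_ rfl) (h C' D' hC' hD')
  refine Finset.sum_congr rfl fun i _ => Finset.sum_congr rfl fun j _ => congrArg _ ?_
  exact setIntegral_congr_set (Measure.set_prod_ae_eq hCC'.symm hDD'.symm)

theorem cutNormDist_nonneg (X Y : ColouredGraphon k) : 0 ≤ X.cutNormDist Y :=
  (add_nonneg (X.discrepancy_nonneg Y ∅ ∅) (X.colourDist_nonneg Y)).trans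
    (X.discrepancy_add_colourDist_le Y nullMeasurableSet_empty nullMeasurableSet_empty)

theorem cutNormDist_comm (X Y : ColouredGraphon k) : X.cutNormDist Y = Y.cutNormDist X := by
  refine le_antisymm (cutNormDist_le fun C D hC hD => ?_) (cutNormDist_le fun C D hC hD => ?_)
  all_goals
    rw [discrepancy_comm, colourDist_comm]
    exact discrepancy_add_colourDist_le _ _ hC.nullMeasurableSet hD.nullMeasurableSet

theorem cutNormDist_triangle (X Y Z : ColouredGraphon k) :
    X.cutNormDist Z ≤ X.cutNormDist Y + Y.cutNormDist Z :=
  cutNormDist_le fun C D hC hD => by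
    linarith [discrepancy_triangle X Y Z C D, colourDist_triangle X Y Z,
      X.discrepancy_add_colourDist_le Y hC.nullMeasurableSet hD.nullMeasurableSet,
      Y.discrepancy_add_colourDist_le Z hC.nullMeasurableSet hD.nullMeasurableSet]

theorem cutNormDist_pullback_eq_zero (X : ColouredGraphon k) {φ ψ : MeasurePreservingMap}
    (h : φ.toFun =ᵐ[volume] ψ.toFun) : (X.pullback φ).cutNormDist (X.pullback ψ) = 0 := by
  refine le_antisymm (cutNormDist_le fun C D _ _ => le_of_eq ?_) (cutNormDist_nonneg _ _)
  have h1 : (X.pullback φ).discrepancy (X.pullback ψ) C D = 0 := by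
    refine Finset.sum_eq_zero fun i _ => Finset.sum_eq_zero fun j _ => ?_
    rw [abs_eq_zero]
    refine integral_eq_zero_of_ae (ae_restrict_of_ae ?_)
    filter_upwards [ae_prod_of_ae_eq h] with z hz
    simp [block_pullback, hz.1, hz.2]
  have h2 : (X.pullback φ).colourDist (X.pullback ψ) = 0 := by
    refine Finset.sum_eq_zero fun i _ => ?_
    rw [measureReal_eq_zero_iff, measure_symmDiff_eq_zero_iff]
    filter_upwards [h] with x hx
    exact congrArg (X.partition.part i) hx
  rw [h1, h2, add_zero]

/-- One pair `C'`, `D'` must serve all `k ^ 2` blocks at once. Fixing the sign of each block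
integral turns the discrepancy into the integral of a single kernel `F`, to which the rectangle
estimate applies; the colour term is invariant under pull-back. -/
theorem cutNormDist_pullback_le (X Y : ColouredGraphon k) (φ : MeasurePreservingMap) :
    (X.pullback φ).cutNormDist (Y.pullback φ) ≤ X.cutNormDist Y := by
  refine cutNormDist_le fun C D _ _ => ?_
  have hcol : (X.pullback φ).colourDist (Y.pullback φ) = X.colourDist Y :=
    Finset.sum_congr rfl fun i _ => congrArg ENNReal.toReal <| φ.volume_preimage _ <|
      NullMeasurableSet.symmDiff_set (X.partition.measurable i) (Y.partition.measurable i)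
  obtain ⟨f, hf, hφf⟩ := φ.exists_measurePreserving_ae_eq
  have hblock : ∀ i j, ∫ z in C ×ˢ D, ((X.pullback φ).block i j z - (Y.pullback φ).block i j z) =
      ∫ z in C ×ˢ D, (X.block i j (f z.1, f z.2) - Y.block i j (f z.1, f z.2)) := fun i j => by
    refine integral_congr_ae (ae_restrict_of_ae ?_)
    filter_upwards [ae_prod_of_ae_eq hφf] with z hz
    simp [block_pullback, hz.1, hz.2]
  have hint : ∀ i j, Integrable (fun z => X.block i j z - Y.block i j z) volume := fun i j =>
    (X.integrable_block i j).sub (Y.integrable_block i j)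
  have hsign : ∀ a : ℝ, ∃ s : ℝ, |s| ≤ 1 ∧ |a| = s * a := fun a => by
    rcases abs_cases a with h | h
    · exact ⟨1, by simp, by simp [h.1]⟩
    · exact ⟨-1, by simp, by simp [h.1]⟩
  choose s hs1 hs using fun i j =>
    hsign (∫ z in C ×ˢ D, (X.block i j (f z.1, f z.2) - Y.block i j (f z.1, f z.2)))
  let F : I × I → ℝ := fun z => ∑ i, ∑ j, s i j * (X.block i j z - Y.block i j z)
  have hF : Integrable F volume := integrable_finsetSum _ fun i _ =>
    integrable_finsetSum _ fun j _ => (hint i j).const_mul _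
  have hff : MeasurePreserving (Prod.map f f) (volume : Measure (I × I)) volume := hf.prod hf
  have hdisc : (X.pullback φ).discrepancy (Y.pullback φ) C D =
      ∫ z in C ×ˢ D, F (f z.1, f z.2) := by
    have hint' : ∀ i j, IntegrableOn
        (fun z => X.block i j (f z.1, f z.2) - Y.block i j (f z.1, f z.2)) (C ×ˢ D) volume :=
      fun i j => (hff.integrable_comp_of_integrable (hint i j)).integrableOn
    simp only [discrepancy, hblock, hs, F]
    rw [integral_finsetSum _ fun i _ => integrable_finsetSum _ fun j _ => (hint' i j).const_mul _]
    refine Finset.sum_congr rfl fun i _ => ?_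
    rw [integral_finsetSum _ fun j _ => (hint' i j).const_mul _]
    exact Finset.sum_congr rfl fun j _ => (integral_const_mul _ _).symm
  obtain ⟨C', D', hC', hD', hle⟩ := exists_setIntegral_pullback_le hf (C := C) (D := D) hF
  have hF' : ∫ z in C' ×ˢ D', F z ≤ X.discrepancy Y C' D' := by
    simp only [F, discrepancy]
    rw [integral_finsetSum _ fun i _ => integrable_finsetSum _ fun j _ =>
      (hint i j).integrableOn.const_mul _]
    refine Finset.sum_le_sum fun i _ => ?_
    rw [integral_finsetSum _ fun j _ => (hint i j).integrableOn.const_mul _]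
    refine Finset.sum_le_sum fun j _ => ?_
    rw [integral_const_mul]
    refine (le_abs_self _).trans ?_
    rw [abs_mul]
    exact mul_le_of_le_one_left (abs_nonneg _) (hs1 i j)
  rw [hdisc, hcol]
  linarith [X.discrepancy_add_colourDist_le Y hC'.nullMeasurableSet hD'.nullMeasurableSet]

theorem cutDist_le (X Y : ColouredGraphon k) (φ ψ : MeasurePreservingMap) :
    X.cutDist Y ≤ (X.pullback φ).cutNormDist (Y.pullback ψ) :=
  csInf_le ⟨0, by rintro r ⟨φ, ψ, rfl⟩; exact cutNormDist_nonneg _ _⟩ ⟨φ, ψ, rfl⟩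

theorem cutDist_set_nonempty (X Y : ColouredGraphon k) :
    {r : ℝ | ∃ φ ψ : MeasurePreservingMap,
      r = cutNormDist (X.pullback φ) (Y.pullback ψ)}.Nonempty :=
  ⟨_, .ofMeasurePreserving id (.id _), .ofMeasurePreserving id (.id _), rfl⟩

theorem exists_cutNormDist_lt {X Y : ColouredGraphon k} {r : ℝ} (h : X.cutDist Y < r) :
    ∃ φ ψ : MeasurePreservingMap, (X.pullback φ).cutNormDist (Y.pullback ψ) < r := by
  obtain ⟨_, ⟨φ, ψ, rfl⟩, hlt⟩ := exists_lt_of_csInf_lt (cutDist_set_nonempty X Y) h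
  exact ⟨φ, ψ, hlt⟩

theorem cutDist_nonneg (X Y : ColouredGraphon k) : 0 ≤ X.cutDist Y :=
  le_csInf (cutDist_set_nonempty X Y) <| by
    rintro r ⟨φ, ψ, rfl⟩; exact cutNormDist_nonneg _ _

theorem cutDist_self (X : ColouredGraphon k) : X.cutDist X = 0 :=
  le_antisymm ((X.cutDist_le X (.ofMeasurePreserving id (.id _))
    (.ofMeasurePreserving id (.id _))).trans_eq
      (X.cutNormDist_pullback_eq_zero (Filter.EventuallyEq.refl _ _)))
    (cutDist_nonneg _ _)

theorem cutDist_comm (X Y : ColouredGraphon k) : X.cutDist Y = Y.cutDist X := by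
  have : ∀ X Y : ColouredGraphon k, X.cutDist Y ≤ Y.cutDist X := fun X Y =>
    le_csInf (cutDist_set_nonempty Y X) <| by
      rintro r ⟨φ, ψ, rfl⟩
      rw [cutNormDist_comm]
      exact cutDist_le _ _ _ _
  exact le_antisymm (this X Y) (this Y X)

/-- Any two measure-preserving maps into `[0,1]` have a common refinement. -/
theorem exists_common_refinement (φ ψ : MeasurePreservingMap) :
    ∃ α β : MeasurePreservingMap, (φ.comp α).toFun =ᵐ[volume] (ψ.comp β).toFun := by
  obtain ⟨f, hf, hφf⟩ := φ.exists_measurePreserving_ae_eq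
  obtain ⟨g, hg, hψg⟩ := ψ.exists_measurePreserving_ae_eq
  -- Both maps are lifted over the identity, so `f ∘ p` and `g ∘ r` both equal the first coordinate
  -- almost everywhere.
  obtain ⟨p, hp, hfp⟩ := exists_measurePreserving_lift hf.measurable measurable_id
    (hf.map_eq.trans Measure.map_id.symm)
  obtain ⟨r, hr, hgr⟩ := exists_measurePreserving_lift hg.measurable measurable_id
    (hg.map_eq.trans Measure.map_id.symm)
  obtain ⟨θ, hθ⟩ := exists_measurePreserving_unitInterval_prod
  refine ⟨.ofMeasurePreserving _ (hp.comp hθ), .ofMeasurePreserving _ (hr.comp hθ), ?_⟩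
  filter_upwards [(hp.comp hθ).quasiMeasurePreserving.ae hφf,
    (hr.comp hθ).quasiMeasurePreserving.ae hψg, hθ.quasiMeasurePreserving.ae hfp,
    hθ.quasiMeasurePreserving.ae hgr] with t h1 h2 h3 h4
  exact (h1.trans h3).trans (h2.trans h4).symm

/-- Two near-optimal pairs of maps involve different pull-backs of `Y`; a common refinement makes
these agree almost everywhere without increasing either distance. -/
theorem cutDist_triangle (X Y Z : ColouredGraphon k) :
    X.cutDist Z ≤ X.cutDist Y + Y.cutDist Z := by
  refine le_of_forall_pos_lt_add fun ε hε => ?_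
  obtain ⟨φ, ψ, h1⟩ := exists_cutNormDist_lt (show X.cutDist Y < X.cutDist Y + ε / 2 by linarith)
  obtain ⟨φ', ψ', h2⟩ := exists_cutNormDist_lt (show Y.cutDist Z < Y.cutDist Z + ε / 2 by linarith)
  obtain ⟨α, β, h⟩ := exists_common_refinement ψ φ'
  have h3 := X.cutDist_le Z (φ.comp α) (ψ'.comp β)
  have h4 := cutNormDist_triangle (X.pullback (φ.comp α)) (Y.pullback (ψ.comp α))
    (Z.pullback (ψ'.comp β))
  have h5 := cutNormDist_triangle (Y.pullback (ψ.comp α)) (Y.pullback (φ'.comp β))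
    (Z.pullback (ψ'.comp β))
  have h6 : (X.pullback (φ.comp α)).cutNormDist (Y.pullback (ψ.comp α)) ≤ _ :=
    cutNormDist_pullback_le (X.pullback φ) (Y.pullback ψ) α
  have h7 : (Y.pullback (φ'.comp β)).cutNormDist (Z.pullback (ψ'.comp β)) ≤ _ :=
    cutNormDist_pullback_le (Y.pullback φ') (Z.pullback ψ') β
  have h8 := Y.cutNormDist_pullback_eq_zero h
  linarith

end ColouredGraphon

/-! ### Tools for passing to the limit -/

open Filter Topology in
theorem tendsto_integral_abs_sub_of_ae_eventually_eq {Ω : Type*} [MeasurableSpace Ω]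
    {μ : Measure Ω} [IsFiniteMeasure μ] {f g : ℕ → Ω → ℝ}
    (hf : ∀ n, AEStronglyMeasurable (f n) μ) (hg : ∀ n, AEStronglyMeasurable (g n) μ) (b : ℝ)
    (hfb : ∀ n z, |f n z| ≤ b) (hgb : ∀ n z, |g n z| ≤ b)
    (h : ∀ᵐ z ∂μ, ∀ᶠ n in atTop, f n z = g n z) :
    Tendsto (fun n => ∫ z, |f n z - g n z| ∂μ) atTop (𝓝 0) := by
  rw [← integral_zero Ω ℝ (μ := μ)]
  refine tendsto_integral_of_dominated_convergence (fun _ => b + b)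
    (fun n => ((hf n).sub (hg n)).norm) (integrable_const _) (fun n => ae_of_all _ fun z => ?_) ?_
  · rw [Real.norm_eq_abs, abs_abs]
    exact (abs_sub _ _).trans (add_le_add (hfb n z) (hgb n z))
  · filter_upwards [h] with z hz
    refine tendsto_const_nhds.congr' ?_
    filter_upwards [hz] with n hn
    simp [hn]

theorem abs_setIntegral_le_of_nullMeasurableSet {F : I × I → ℝ} {ε : ℝ}
    (h : ∀ C D : Set I, MeasurableSet C → MeasurableSet D → |∫ z in C ×ˢ D, F z| ≤ ε)
    {C D : Set I} (hC : NullMeasurableSet C (volume : Measure I))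
    (hD : NullMeasurableSet D (volume : Measure I)) : |∫ z in C ×ˢ D, F z| ≤ ε := by
  obtain ⟨C', -, hC', hCC'⟩ := hC.exists_measurable_superset_ae_eq
  obtain ⟨D', -, hD', hDD'⟩ := hD.exists_measurable_superset_ae_eq
  refine le_of_eq_of_le (congrArg _ ?_) (h C' D' hC' hD')
  exact setIntegral_congr_set (Measure.set_prod_ae_eq hCC'.symm hDD'.symm)

theorem indicator_one_eq_of_mem_iff {α β : Type*} {E : Set α} {F : Set β} {x : α} {y : β}
    (h : x ∈ E ↔ y ∈ F) : E.indicator (1 : α → ℝ) x = F.indicator (1 : β → ℝ) y := by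
  by_cases hy : y ∈ F
  · simp [hy, h.2 hy]
  · simp [hy, h.not.2 hy]

theorem measurable_stepKernel (ε : ℝ) (n : ℕ) {S T S' T' : ℕ → Set I}
    (hS : ∀ i, MeasurableSet (S i)) (hT : ∀ i, MeasurableSet (T i))
    (hS' : ∀ i, MeasurableSet (S' i)) (hT' : ∀ i, MeasurableSet (T' i)) :
    Measurable (stepKernel ε n S T S' T') := by
  unfold stepKernel
  exact (Finset.measurable_sum _ fun i _ =>
    (measurable_one.indicator ((hS i).prod (hT i))).sub
      (measurable_one.indicator ((hS' i).prod (hT' i)))).const_mul ε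

theorem abs_stepKernel_le {ε : ℝ} (hε : 0 ≤ ε) (n : ℕ) (S T S' T' : ℕ → Set I) (z : I × I) :
    |stepKernel ε n S T S' T' z| ≤ ε * n := by
  have hind : ∀ E : Set (I × I), E.indicator (1 : I × I → ℝ) z ∈ Set.Icc (0 : ℝ) 1 := fun E => by
    by_cases h : z ∈ E <;> simp [h]
  rw [stepKernel, abs_mul, abs_of_nonneg hε]
  refine mul_le_mul_of_nonneg_left ?_ hε
  refine (Finset.abs_sum_le_sum_abs _ _).trans ?_
  refine (Finset.sum_le_sum (g := fun _ => (1 : ℝ)) fun i _ => ?_).trans (by simp)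
  have h1 := hind (S i ×ˢ T i)
  have h2 := hind (S' i ×ˢ T' i)
  exact abs_le.2 ⟨by linarith [h1.1, h2.2], by linarith [h1.2, h2.1]⟩

theorem Graphon.integrable (U : Graphon) : Integrable U.toFun (volume : Measure (I × I)) :=
  Integrable.of_bound U.measurable.aemeasurable.aestronglyMeasurable 1 <| ae_of_all _ fun z => by
    rw [Real.norm_of_nonneg (U.mem_Icc z).1]
    exact (U.mem_Icc z).2

theorem Graphon.exists_stepKernel_approx (U : Graphon) (l : ℕ) :
    ∃ S T S' T' : ℕ → Set I, (∀ i, MeasurableSet (S i)) ∧ (∀ i, MeasurableSet (T i)) ∧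
      (∀ i, MeasurableSet (S' i)) ∧ (∀ i, MeasurableSet (T' i)) ∧
      ∀ C D : Set I, MeasurableSet C → MeasurableSet D →
        |∫ z in C ×ˢ D, (U.toFun z - stepKernel (1 / (l + 1)) ((l + 1) ^ 2) S T S' T' z)| ≤
          1 / (l + 1) := by
  have hl : (0 : ℝ) < l + 1 := by positivity
  refine _root_.exists_stepKernel_approx (by positivity) _ U.toFun ?_ ?_
  · exact MemLp.of_bound U.integrable.aestronglyMeasurable 1 <| ae_of_all _ fun z => by
      rw [Real.norm_of_nonneg (U.mem_Icc z).1]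
      exact (U.mem_Icc z).2
  -- With `ε = 1 / (l + 1)`, taking `(l + 1) ^ 2` steps makes the energy budget exactly 1, which
  -- bounds the energy of any graphon.
  · have h1 : (((l + 1) ^ 2 : ℕ) : ℝ) * (1 / ((l : ℝ) + 1)) ^ 2 = 1 := by
      push_cast
      field_simp
    rw [h1]
    refine (integral_mono_of_nonneg (ae_of_all _ fun z => sq_nonneg _)
      (integrable_const (1 : ℝ)) (ae_of_all _ fun z => ?_)).trans (by simp)
    have := U.mem_Icc z
    exact pow_le_one₀ this.1 this.2

theorem OrderedPartition.existsUnique_mem {k : ℕ} (A : OrderedPartition k) (x : I) :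
    ∃! i, x ∈ A.part i := by
  obtain ⟨i, hi⟩ := Set.mem_iUnion.1 (A.iUnion_eq ▸ Set.mem_univ x)
  refine ⟨i, hi, fun j hj => ?_⟩
  by_contra hne
  exact Set.disjoint_left.1 (A.disjoint j i hne) hj hi

/-- Points of the exceptional null set receive the default colour `i₀`. -/
theorem exists_orderedPartition_ae_eq {k : ℕ} (i₀ : Fin k) {B : Fin k → Set I}
    (hB : ∀ i, MeasurableSet (B i)) (h : ∀ᵐ t : I, ∃! i, t ∈ B i) :
    ∃ P : OrderedPartition k, ∀ i, P.part i =ᵐ[volume] B i := by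
  classical
  let c : I → Fin k := fun t => if ht : ∃! i, t ∈ B i then ht.choose else i₀
  have hc : ∀ i, (c ⁻¹' {i} : Set I) =ᵐ[volume] B i := by
    intro i
    filter_upwards [h] with t ht
    refine propext (show c t = i ↔ t ∈ B i from ?_)
    simp only [c, dif_pos ht]
    exact ⟨fun e => e ▸ ht.choose_spec.1, fun hi => (ht.choose_spec.2 i hi).symm⟩
  refine ⟨⟨fun i => c ⁻¹' {i}, fun i => (hB i).nullMeasurableSet.congr (hc i).symm,
    fun i j hij => ?_, ?_⟩, hc⟩
  · exact Disjoint.preimage _ (Set.disjoint_singleton.2 hij)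
  · rw [← Set.preimage_iUnion, Set.iUnion_of_singleton, Set.preimage_univ]

/-! ### Sequential compactness -/

namespace ColouredGraphon

variable {k : ℕ}

open Filter Topology

/-- The partition is exchanged first, at an `L¹` cost. Once the partitions agree, restricting to a
block only replaces `C × D` by a smaller rectangle. -/
theorem abs_setIntegral_block_sub_le (X Y : ColouredGraphon k) {ε : ℝ}
    (h : ∀ C D : Set I, MeasurableSet C → MeasurableSet D →
      |∫ z in C ×ˢ D, (X.graphon.toFun z - Y.graphon.toFun z)| ≤ ε)
    {C D : Set I} (hC : MeasurableSet C) (hD : MeasurableSet D) (i j : Fin k) :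
    |∫ z in C ×ˢ D, (X.block i j z - Y.block i j z)| ≤
      ε + ∫ z, |X.block i j z - block ⟨X.graphon, Y.partition⟩ i j z| := by
  let Z : ColouredGraphon k := ⟨X.graphon, Y.partition⟩
  have hE : NullMeasurableSet (Y.partition.part i ×ˢ Y.partition.part j)
      (volume : Measure (I × I)) :=
    (Y.partition.measurable i).prod (Y.partition.measurable j)
  have h1 : ∫ z in C ×ˢ D, (X.block i j z - Y.block i j z) =
      (∫ z in C ×ˢ D, (X.block i j z - Z.block i j z)) +
        ∫ z in C ×ˢ D, (Z.block i j z - Y.block i j z) := by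
    rw [integral_sub (X.integrable_block i j).integrableOn (Y.integrable_block i j).integrableOn,
      integral_sub (X.integrable_block i j).integrableOn (Z.integrable_block i j).integrableOn,
      integral_sub (Z.integrable_block i j).integrableOn (Y.integrable_block i j).integrableOn]
    ring
  have h2 : ∫ z in C ×ˢ D, (Z.block i j z - Y.block i j z) =
      ∫ z in (C ∩ Y.partition.part i) ×ˢ (D ∩ Y.partition.part j),
        (X.graphon.toFun z - Y.graphon.toFun z) := by
    rw [← Set.prod_inter_prod, Set.inter_comm,
      ← Measure.restrict_restrict₀ (hE.mono_ac Measure.restrict_le_self.absolutelyContinuous),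
      ← integral_indicator₀ (hE.mono_ac Measure.restrict_le_self.absolutelyContinuous)]
    refine integral_congr_ae (ae_of_all _ fun z => ?_)
    exact (congrFun (Set.indicator_sub _ X.graphon.toFun Y.graphon.toFun) z).symm
  have h3 : |∫ z in C ×ˢ D, (X.block i j z - Z.block i j z)| ≤
      ∫ z, |X.block i j z - Z.block i j z| :=
    abs_integral_le_integral_abs.trans <| setIntegral_le_integral
      ((X.integrable_block i j).sub (Z.integrable_block i j)).abs
      (ae_of_all _ fun _ => abs_nonneg _)
  have h4 := abs_setIntegral_le_of_nullMeasurableSet h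
    (hC.nullMeasurableSet.inter (Y.partition.measurable i))
    (hD.nullMeasurableSet.inter (Y.partition.measurable j))
  rw [h1, h2]
  exact (abs_add_le _ _).trans (by linarith)

theorem cutNormDist_le_of_graphon (X Y : ColouredGraphon k) {ε : ℝ}
    (h : ∀ C D : Set I, MeasurableSet C → MeasurableSet D →
      |∫ z in C ×ˢ D, (X.graphon.toFun z - Y.graphon.toFun z)| ≤ ε) :
    X.cutNormDist Y ≤ (k : ℝ) ^ 2 * ε +
      ((∑ i, ∑ j, ∫ z, |X.block i j z - block ⟨X.graphon, Y.partition⟩ i j z|) +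
        X.colourDist Y) := by
  refine cutNormDist_le fun C D hC hD => ?_
  rw [← add_assoc]
  refine add_le_add ?_ le_rfl
  have h1 : (k : ℝ) ^ 2 * ε = ∑ _i : Fin k, ∑ _j : Fin k, ε := by
    simp only [Finset.sum_const, Finset.card_univ, Fintype.card_fin, nsmul_eq_mul]
    ring
  rw [h1, ← Finset.sum_add_distrib]
  simp only [← Finset.sum_add_distrib]
  exact Finset.sum_le_sum fun i _ => Finset.sum_le_sum fun j _ =>
    abs_setIntegral_block_sub_le X Y h hC hD i j

/-- If graphons converge in cut norm and the colour classes converge almost everywhere, then the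
coloured graphons converge. -/
theorem tendsto_cutNormDist (X : ℕ → ColouredGraphon k) (Y : ColouredGraphon k)
    (hcut : ∀ ε > 0, ∀ᶠ n in atTop, ∀ C D : Set I, MeasurableSet C → MeasurableSet D →
      |∫ z in C ×ˢ D, ((X n).graphon.toFun z - Y.graphon.toFun z)| ≤ ε)
    (hcol : ∀ᵐ t : I, ∀ i, ∀ᶠ n in atTop,
      (t ∈ (X n).partition.part i ↔ t ∈ Y.partition.part i)) :
    Tendsto (fun n => (X n).cutNormDist Y) atTop (𝓝 0) := by
  have hblock : ∀ i j, Tendsto (fun n => ∫ z, |(X n).block i j z -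
      block ⟨(X n).graphon, Y.partition⟩ i j z|) atTop (𝓝 0) := by
    intro i j
    have hb : ∀ (Z : ColouredGraphon k) z, |Z.block i j z| ≤ 1 := fun Z z => by
      rw [abs_of_nonneg (Z.block_mem_Icc i j z).1]
      exact (Z.block_mem_Icc i j z).2
    refine tendsto_integral_abs_sub_of_ae_eventually_eq
      (fun n => ((X n).integrable_block i j).aestronglyMeasurable)
      (fun n => (integrable_block _ i j).aestronglyMeasurable) 1 (fun n => hb _) (fun n => hb _) ?_
    have h1 : ∀ᵐ z : I × I, ∀ i, ∀ᶠ n in atTop,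
        (z.1 ∈ (X n).partition.part i ↔ z.1 ∈ Y.partition.part i) :=
      (Measure.quasiMeasurePreserving_fst (μ := (volume : Measure I)) (ν := volume)).ae hcol
    have h2 : ∀ᵐ z : I × I, ∀ i, ∀ᶠ n in atTop,
        (z.2 ∈ (X n).partition.part i ↔ z.2 ∈ Y.partition.part i) :=
      (Measure.quasiMeasurePreserving_snd (μ := (volume : Measure I)) (ν := volume)).ae hcol
    filter_upwards [h1, h2] with z hz1 hz2
    filter_upwards [hz1 i, hz2 j] with n hn1 hn2
    have : z ∈ (X n).partition.part i ×ˢ (X n).partition.part j ↔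
        z ∈ Y.partition.part i ×ˢ Y.partition.part j := and_congr hn1 hn2
    by_cases hz : z ∈ Y.partition.part i ×ˢ Y.partition.part j
    · rw [block, block, Set.indicator_of_mem hz, Set.indicator_of_mem (this.2 hz)]
    · rw [block, block, Set.indicator_of_notMem hz, Set.indicator_of_notMem (this.not.2 hz)]
  have hcolour : Tendsto (fun n => (X n).colourDist Y) atTop (𝓝 0) := by
    rw [← Finset.sum_const_zero (s := (Finset.univ : Finset (Fin k)))]
    refine tendsto_finsetSum _ fun i _ => ?_
    have hA : ∀ n, NullMeasurableSet (symmDiff ((X n).partition.part i) (Y.partition.part i))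
        (volume : Measure I) := fun n =>
      NullMeasurableSet.symmDiff_set ((X n).partition.measurable i) (Y.partition.measurable i)
    have h1 := tendsto_integral_abs_sub_of_ae_eventually_eq (μ := (volume : Measure I))
      (f := fun n => (symmDiff ((X n).partition.part i) (Y.partition.part i)).indicator 1)
      (g := fun _ _ => 0)
      (fun n => (aemeasurable_one.indicator₀ (hA n)).aestronglyMeasurable)
      (fun n => aestronglyMeasurable_const) 1
      (fun n z => by
        by_cases h : z ∈ symmDiff ((X n).partition.part i) (Y.partition.part i) <;> simp [h])
      (fun n z => by simp) (by
        filter_upwards [hcol] with t ht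
        filter_upwards [ht i] with n hn
        refine Set.indicator_of_notMem ?_ _
        rw [Set.mem_symmDiff]
        tauto)
    refine h1.congr fun n => ?_
    have h2 : ∀ z, |(symmDiff ((X n).partition.part i) (Y.partition.part i)).indicator
        (1 : I → ℝ) z - 0| =
        (symmDiff ((X n).partition.part i) (Y.partition.part i)).indicator 1 z := fun z => by
      rw [sub_zero]
      exact abs_of_nonneg (Set.indicator_nonneg (fun _ _ => zero_le_one) z)
    simp only [h2]
    rw [integral_indicator₀ (hA n)]
    simp
  have hrest : Tendsto (fun n => (∑ i, ∑ j, ∫ z, |(X n).block i j z -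
      block ⟨(X n).graphon, Y.partition⟩ i j z|) + (X n).colourDist Y) atTop (𝓝 0) := by
    have h1 := (tendsto_finsetSum (Finset.univ : Finset (Fin k)) fun i _ =>
      tendsto_finsetSum (Finset.univ : Finset (Fin k)) fun j _ => hblock i j).add hcolour
    simpa using h1
  rw [Metric.tendsto_atTop']
  have hk : (0 : ℝ) < (k : ℝ) ^ 2 + 1 := by positivity
  intro ε hε
  -- The `k ^ 2` blocks together cost at most `ε / 2`; the added 1 keeps the denominator positive.
  have hev := (hcut (ε / (2 * ((k : ℝ) ^ 2 + 1))) (by positivity)).and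
    (hrest.eventually_lt_const (show 0 < ε / 2 by positivity))
  obtain ⟨N, hN⟩ := eventually_atTop.1 hev
  refine ⟨N, fun n hn => ?_⟩
  obtain ⟨h1, h2⟩ := hN n hn.le
  rw [Real.dist_eq, sub_zero, abs_of_nonneg (cutNormDist_nonneg _ _)]
  have h3 := cutNormDist_le_of_graphon (X n) Y h1
  have h4 : (k : ℝ) ^ 2 * (ε / (2 * ((k : ℝ) ^ 2 + 1))) ≤ ε / 2 := by
    rw [mul_div_assoc', div_le_div_iff₀ (by positivity) (by positivity)]
    nlinarith
  linarith

/-- Every sequence of coloured graphons has a subsequence converging in cut distance. -/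
theorem exists_subseq_tendsto_cutDist (X : ℕ → ColouredGraphon k) :
    ∃ (s : ℕ → ℕ) (Y : ColouredGraphon k), StrictMono s ∧
      Tendsto (fun n => (X (s n)).cutDist Y) atTop (𝓝 0) := by
  choose S T S' T' hS hT hS' hT' happ using fun n l => (X n).graphon.exists_stepKernel_approx l
  choose A _ hA hAX using fun n i => ((X n).partition.measurable i).exists_measurable_superset_ae_eq
  -- One countable family holds the Borel versions of the colour classes and the four kinds of
  -- rectangle sides at every accuracy `l`, so a single rearrangement handles them all.
  let Q : ℕ → Fin k ⊕ (Fin 4 × ℕ × ℕ) → Set I := fun n =>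
    Sum.elim (A n) fun p => (![S n p.2.1 p.2.2, T n p.2.1 p.2.2, S' n p.2.1 p.2.2,
      T' n p.2.1 p.2.2] : Fin 4 → Set I) p.1
  have hQ : ∀ n j, MeasurableSet (Q n j) := by
    rintro n (i | ⟨c, l, i⟩)
    · exact hA n i
    · fin_cases c
      exacts [hS n l i, hT n l i, hS' n l i, hT' n l i]
  obtain ⟨s₁, φ₁, B, hs₁, hφ₁, hB, hlim₁⟩ := exists_rearrangement Q hQ
  obtain ⟨s₂, W, hs₂, hW⟩ := exists_graphon_weak_subseq_limit fun n =>
    (X (s₁ n)).graphon.pullback (.ofMeasurePreserving (φ₁ n) (hφ₁ n))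
  let s : ℕ → ℕ := s₁ ∘ s₂
  let φ : ℕ → I → I := φ₁ ∘ s₂
  have hφ : ∀ n, MeasurePreserving (φ n) := fun n => hφ₁ _
  have hlim : ∀ᵐ t : I, ∀ j, ∀ᶠ n in atTop, (φ n t ∈ Q (s n) j ↔ t ∈ B j) := by
    refine ae_all_iff.2 fun j => ?_
    filter_upwards [hlim₁ j] with t ht
    exact hs₂.tendsto_atTop.eventually ht
  have hcol : ∀ᵐ t : I, ∀ i, ∀ᶠ n in atTop,
      (φ n t ∈ (X (s n)).partition.part i ↔ t ∈ B (Sum.inl i)) := by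
    have h1 : ∀ᵐ t : I, ∀ n i, (φ n t ∈ A (s n) i ↔ φ n t ∈ (X (s n)).partition.part i) :=
      ae_all_iff.2 fun n => ae_all_iff.2 fun i => by
        filter_upwards [(hφ n).quasiMeasurePreserving.ae (hAX (s n) i)] with t ht
        exact iff_of_eq ht
    filter_upwards [h1, hlim] with t ht1 ht2 i
    filter_upwards [ht2 (Sum.inl i)] with n hn
    exact (ht1 n i).symm.trans hn
  have huniq : ∀ᵐ t : I, ∃! i, t ∈ B (Sum.inl i) := by
    filter_upwards [hcol] with t ht
    -- There are finitely many colours, so a single `n` matches all of them, and uniqueness of the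
    -- colour is inherited from that partition.
    obtain ⟨n, hn⟩ := (eventually_all.2 ht).exists
    simpa only [hn] using (X (s n)).partition.existsUnique_mem (φ n t)
  -- The default colour is that of the point 0 in `X 0`, so no separate assumption `k ≥ 1` is
  -- needed.
  obtain ⟨P, hP⟩ := exists_orderedPartition_ae_eq ((X 0).partition.existsUnique_mem 0).choose
    (fun i => hB (Sum.inl i)) huniq
  refine ⟨s, ⟨W, P⟩, hs₁.comp hs₂, ?_⟩
  refine squeeze_zero (fun n => cutDist_nonneg _ _) (fun n => cutDist_le _ _
    (.ofMeasurePreserving (φ n) (hφ n)) (.ofMeasurePreserving id (.id _))) ?_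
  refine tendsto_cutNormDist _ _ (fun ε hε => ?_) ?_
  · refine eventually_abs_setIntegral_sub_le (fun n => Graphon.integrable _) W.integrable hW
      (fun δ hδ => ?_) hε
    obtain ⟨l, hl⟩ := exists_nat_one_div_lt hδ
    have hl0 : (0 : ℝ) ≤ 1 / (l + 1) := by positivity
    let K₀ : ℕ → I × I → ℝ := fun n => stepKernel (1 / (l + 1)) ((l + 1) ^ 2) (S (s n) l)
      (T (s n) l) (S' (s n) l) (T' (s n) l)
    let L : I × I → ℝ := stepKernel (1 / (l + 1)) ((l + 1) ^ 2) (fun i => B (Sum.inr (0, l, i)))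
      (fun i => B (Sum.inr (1, l, i))) (fun i => B (Sum.inr (2, l, i)))
      (fun i => B (Sum.inr (3, l, i)))
    have hK₀ : ∀ n, Measurable (K₀ n) := fun n =>
      measurable_stepKernel _ _ (hS _ _) (hT _ _) (hS' _ _) (hT' _ _)
    have hL : Measurable L := measurable_stepKernel _ _ (fun _ => hB _) (fun _ => hB _)
      (fun _ => hB _) (fun _ => hB _)
    have hK : ∀ n, Measurable fun z : I × I => K₀ n (φ n z.1, φ n z.2) := fun n =>
      (hK₀ n).comp ((hφ n).measurable.prodMap (hφ n).measurable)
    have hKb : ∀ n z, |K₀ n z| ≤ 1 / (l + 1) * ((l + 1) ^ 2 : ℕ) := fun n z =>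
      abs_stepKernel_le hl0 _ _ _ _ _ z
    have hLb : ∀ z, |L z| ≤ 1 / (l + 1) * ((l + 1) ^ 2 : ℕ) := fun z =>
      abs_stepKernel_le hl0 _ _ _ _ _ z
    refine ⟨fun n z => K₀ n (φ n z.1, φ n z.2), L,
      fun n => Integrable.of_bound (hK n).aestronglyMeasurable _ (ae_of_all _ fun z => hKb n _),
      Integrable.of_bound hL.aestronglyMeasurable _ (ae_of_all _ hLb), ?_, fun n C D hC hD => ?_⟩
    · refine tendsto_integral_abs_sub_of_ae_eventually_eq (fun n => (hK n).aestronglyMeasurable)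
        (fun _ => hL.aestronglyMeasurable) _ (fun n z => hKb n _) (fun _ => hLb) ?_
      have h1 : ∀ᵐ z : I × I, ∀ j, ∀ᶠ n in atTop, (φ n z.1 ∈ Q (s n) j ↔ z.1 ∈ B j) :=
        (Measure.quasiMeasurePreserving_fst (μ := (volume : Measure I)) (ν := volume)).ae hlim
      have h2 : ∀ᵐ z : I × I, ∀ j, ∀ᶠ n in atTop, (φ n z.2 ∈ Q (s n) j ↔ z.2 ∈ B j) :=
        (Measure.quasiMeasurePreserving_snd (μ := (volume : Measure I)) (ν := volume)).ae hlim
      filter_upwards [h1, h2] with z hz1 hz2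
      -- Only `(l + 1) ^ 2` terms occur, so all their sides stabilise simultaneously.
      have hall : ∀ᶠ n in atTop, ∀ i ∈ Finset.range ((l + 1) ^ 2),
          (φ n z.1 ∈ S (s n) l i ↔ z.1 ∈ B (Sum.inr (0, l, i))) ∧
          (φ n z.2 ∈ T (s n) l i ↔ z.2 ∈ B (Sum.inr (1, l, i))) ∧
          (φ n z.1 ∈ S' (s n) l i ↔ z.1 ∈ B (Sum.inr (2, l, i))) ∧
          (φ n z.2 ∈ T' (s n) l i ↔ z.2 ∈ B (Sum.inr (3, l, i))) :=
        (Finset.eventually_all _).2 fun i _ =>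
          (hz1 (Sum.inr (0, l, i))).and ((hz2 (Sum.inr (1, l, i))).and
            ((hz1 (Sum.inr (2, l, i))).and (hz2 (Sum.inr (3, l, i)))))
      filter_upwards [hall] with n hn
      refine congrArg _ (Finset.sum_congr rfl fun i hi => ?_)
      obtain ⟨e1, e2, e3, e4⟩ := hn i hi
      exact congrArg₂ _ (indicator_one_eq_of_mem_iff (and_congr e1 e2))
        (indicator_one_eq_of_mem_iff (and_congr e3 e4))
    -- The regularity bound survives the rearrangement, uniformly in `n`.
    · exact (abs_setIntegral_pullback_le (hφ n)
        ((X (s n)).graphon.integrable.sub (Integrable.of_bound (hK₀ n).aestronglyMeasurable _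
          (ae_of_all _ (hKb n)))) (happ (s n) l) C D).trans hl.le
  · have hP' : ∀ᵐ t : I, ∀ i, (t ∈ P.part i ↔ t ∈ B (Sum.inl i)) :=
      ae_all_iff.2 fun i => by
        filter_upwards [hP i] with t ht
        exact iff_of_eq ht
    filter_upwards [hcol, hP'] with t ht hPt i
    filter_upwards [ht i] with n hn
    exact hn.trans (hPt i).symm

end ColouredGraphon

/-! ### The quotient metric space -/

namespace ColouredGraphonSpace

variable {k : ℕ}

theorem cutDist_congr_left {X X' : ColouredGraphon k} (h : X.cutDist X' = 0)
    (Y : ColouredGraphon k) : X.cutDist Y = X'.cutDist Y := by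
  have h1 := X.cutDist_triangle X' Y
  have h2 := X'.cutDist_triangle X Y
  rw [X'.cutDist_comm X] at h2
  linarith

/-- The cut distance on classes of coloured graphons. -/
def cutDist : ColouredGraphonSpace k → ColouredGraphonSpace k → ℝ :=
  Quot.lift₂ ColouredGraphon.cutDist
    (fun X Y Y' h => by
      rw [X.cutDist_comm Y, X.cutDist_comm Y', cutDist_congr_left h])
    (fun _ _ Y h => cutDist_congr_left h Y)

/-- The metric on the space of coloured graphons given by the cut distance. -/
abbrev cutMetric (k : ℕ) : MetricSpace (ColouredGraphonSpace k) where
  dist := cutDist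
  dist_self := by
    rintro ⟨X⟩
    exact X.cutDist_self
  dist_comm := by
    rintro ⟨X⟩ ⟨Y⟩
    exact X.cutDist_comm Y
  dist_triangle := by
    rintro ⟨X⟩ ⟨Y⟩ ⟨Z⟩
    exact X.cutDist_triangle Y Z
  eq_of_dist_eq_zero := by
    rintro ⟨X⟩ ⟨Y⟩ h
    exact Quot.sound h

open Filter in
theorem compactSpace_cutMetric (k : ℕ) :
    @CompactSpace _ (cutMetric k).toUniformSpace.toTopologicalSpace := by
  let _ := cutMetric k
  -- In a metric space sequential compactness suffices, and it can be checked on representatives.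
  rw [compactSpace_iff_seqCompactSpace]
  refine ⟨fun x _ => ?_⟩
  choose X hX using fun n => Quot.exists_rep (x n)
  obtain ⟨s, Y, hs, hlim⟩ := ColouredGraphon.exists_subseq_tendsto_cutDist X
  refine ⟨Y.toSpace, Set.mem_univ _, s, hs, tendsto_iff_dist_tendsto_zero.2 ?_⟩
  refine hlim.congr fun n => ?_
  simp only [Function.comp, ← hX]
  rfl

end ColouredGraphonSpace

end

theorem theorem3p1 (k : ℕ) :
    ∃ m : MetricSpace (ColouredGraphonSpace k),
      (∀ X Y : ColouredGraphon k, dist X.toSpace Y.toSpace = X.cutDist Y) ∧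
      CompactSpace (ColouredGraphonSpace k) :=
  ⟨ColouredGraphonSpace.cutMetric k, fun _ _ => rfl,
    ColouredGraphonSpace.compactSpace_cutMetric k⟩
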